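/- **Hodge star for the 4D calculus on $k_q[SL_2]$.** Let $k$ be a field, $q\in k^\times$ with $q^2\neq\pm1$, and $\lambda=1-q^{-2}$. *Setting.* Let $A=k_q[SL_2]$ be the algebra generated by $t=\begin{pmatrix}a&b\\c&d\end{pmatrix}$ with relations $ba=qab$, $ca=qac$, $db=qbd$, $dc=qcd$, $bc=cb$, $ad-q^{-1}bc=1$, $da-qbc=1$, and antipode $Sa=d$, $Sb=-qb$, $Sc=-q^{-1}c$, $Sd=a$. Let $\Lambda^1=M_2(k)$ with basis $e_a=E_1{}^1$, $e_b=E_1{}^2$, $e_c=E_2{}^1$, $e_d=E_2{}^2$, which is a right $A$-crossed module by $$\Delta_RE_\alpha{}^\beta=\sum E_m{}^n\otimes t^m{}_\alpha S t^\beta{}_n,\qquad E_\alpha{}^\beta\triangleleft t^i{}_j=q^{-1}\sum R^m{}_\alpha{}^i{}_p\,R^p{}_j{}^\beta{}_n\,E_m{}^n,$$ where the nonzero entries of $R$ are $R^1{}_1{}^1{}_1=R^2{}_2{}^2{}_2=q$, $R^1{}_1{}^2{}_2=R^2{}_2{}^1{}_1=1$, $R^1{}_2{}^2{}_1=q-q^{-1}$.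 This is the left-invariant part of Woronowicz's 4D calculus. Let $\Psi(v\otimes w)=w_{(0)}\otimes v\triangleleft w_{(1)}$ be the crossed module braiding (with $\Delta_Rw=w_{(0)}\otimes w_{(1)}$), let $[m,-\Psi]=\mathrm{id}-\Psi_1+\Psi_1\Psi_2-\cdots+(-1)^{m-1}\Psi_1\cdots\Psi_{m-1}$ and $[m,-\Psi]!=(\mathrm{id}\otimes[m-1,-\Psi]!)[m,-\Psi]$ on $(\Lambda^1)^{\otimes m}$, with $[0,-\Psi]!=[1,-\Psi]!=\mathrm{id}$, and let $$\Lambda=B_-(\Lambda^1)=T\Lambda^1/\textstyle\bigoplus_m\ker[m,-\Psi]!,\qquad \Omega=A\otimes\Lambda .$$ With $e_z=q^{-2}e_a-e_d$ and $\theta=e_a+e_d$, use the metric $$g=e_c\otimes e_b+q^2e_b\otimes e_c+\frac{q^3}{q+q^{-1}}(e_z\otimes e_z-\theta\otimes\theta)=\sum g^{ij}e_i\otimes e_j$$ to identify $\Lambda^{1*}$ with $\Lambda^1$, sending the dual basis vector $f^i$ to $\sum_jg^{ij}e_j$. Let $\exp=\sum_m([m,-\Psi]!^{-1}\otimes\mathrm{id})\,\mathrm{coev}_{(\Lambda^1)^{\otimes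 m}}\in\Lambda\otimes\Lambda$, where $\mathrm{coev}=\sum e_{i_1}\otimes\cdots\otimes e_{i_m}\otimes f^{i_m}\otimes\cdots\otimes f^{i_1}$ with its second factor carried to $\Lambda$ by $g$, and $[m,-\Psi]!^{-1}$ denotes any inverse image. Let $\int:\Lambda\to k$ be linear with $\int\mathrm{Vol}=1$ for $\mathrm{Vol}=e_ae_be_ce_d$ and zero in degrees $\ne4$. The Hodge star is the super-braided Fourier transform $$\sharp:\Lambda\to\Lambda,\qquad \sharp\omega=(\textstyle\int\otimes\mathrm{id})(\omega\exp),$$ extended to $\Omega$ as a left $A$-module map $\mathrm{id}_A\otimes\sharp$; and $\mu=(\int\otimes\int)\exp$. *Statement.* The dimension of $\Lambda^m$ is $\binom4m$ for every $m\ge0$ (so $1,4,6,4,1$, and $0$ above degree $4$), $\int$ exists and is unique, and in every degree the component of $\exp$ exists and is independent of the choice of inverse image, so that $\sharp$ is well defined. Moreover $\mu=q^6$ and $$\sharp1=q^6\,\mathrm{Vol},\qquad \sharp\mathrm{Vol}=1,$$ $$\sharp e_a=-q^4e_ae_be_c,\quad \sharp e_b=-q^4e_ae_be_d,\quad \sharp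 e_c=q^6e_ae_ce_d,\quad \sharp e_d=q^4e_be_ce_d+\lambda q^4e_ae_be_c,$$ $$\sharp(e_ae_b)=-q^2e_ae_b,\quad \sharp(e_ae_c)=q^4e_ae_c,\quad \sharp(e_ae_d)=q^2e_be_c+\lambda q^4e_ae_d,$$ $$\sharp(e_be_c)=q^4e_ae_d,\quad \sharp(e_be_d)=q^4e_be_d+(1-q^4)e_ae_b,\quad \sharp(e_ce_d)=-q^2e_ce_d,$$ $$\sharp(e_ae_be_c)=-q^2e_a,\quad \sharp(e_ae_be_d)=-q^2e_b,\quad \sharp(e_ae_ce_d)=e_c,\quad \sharp(e_be_ce_d)=q^2e_d+\lambda q^2e_a .$$ On $\Lambda$, and likewise on $\Omega$, one has in degree $D$ $$\sharp^2=q^6\quad(D\neq2),\qquad (\sharp-q^4)(\sharp+q^2)=0\quad(D=2).$$ Consequently the normalised operator $\sharp'=q^{-3}\sharp$ satisfies $\sharp'^2=\mathrm{id}$ for $D\ne2$ and the $q$-Hecke relation $\sharp'^2=\mathrm{id}+(q-q^{-1})\sharp'$ for $D=2$. -/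

import Mathlib

open scoped TensorProduct

namespace QHodge

noncomputable section

/-- Index set of the basis `E_α^β` of `Λ¹ = M₂(k)`: the pair `(α, β)`, with matrix indices `0, 1`
instead of `1, 2`. -/
abbrev Idx : Type := Fin 2 × Fin 2

variable {k : Type*} [Field k]

/-! ### The quantum group `A = k_q[SL₂]` -/

/-- The generators `t^i_j` in the free algebra (`a = t 0 0`, `b = t 0 1`, `c = t 1 0`,
`d = t 1 1`). -/
def freeT (k : Type*) [Field k] (i j : Fin 2) : FreeAlgebra k Idx := FreeAlgebra.ι k (i, j)

/-- Relations of `k_q[SL₂]`: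
`ba = qab, ca = qac, db = qbd, dc = qcd, bc = cb, ad - q⁻¹bc = 1, da - qbc = 1`. -/
inductive SL2Rel (q : kˣ) : FreeAlgebra k Idx → FreeAlgebra k Idx → Prop
  | ba : SL2Rel q (freeT k 0 1 * freeT k 0 0) ((q : k) • (freeT k 0 0 * freeT k 0 1))
  | ca : SL2Rel q (freeT k 1 0 * freeT k 0 0) ((q : k) • (freeT k 0 0 * freeT k 1 0))
  | db : SL2Rel q (freeT k 1 1 * freeT k 0 1) ((q : k) • (freeT k 0 1 * freeT k 1 1))
  | dc : SL2Rel q (freeT k 1 1 * freeT k 1 0) ((q : k) • (freeT k 1 0 * freeT k 1 1))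
  | bc : SL2Rel q (freeT k 0 1 * freeT k 1 0) (freeT k 1 0 * freeT k 0 1)
  | ad : SL2Rel q (freeT k 0 0 * freeT k 1 1 - (q : k)⁻¹ • (freeT k 0 1 * freeT k 1 0)) 1
  | da : SL2Rel q (freeT k 1 1 * freeT k 0 0 - (q : k) • (freeT k 0 1 * freeT k 1 0)) 1

/-- The algebra `A = k_q[SL₂]`. -/
def QSL2 (q : kˣ) : Type _ := RingQuot (SL2Rel q)

instance (q : kˣ) : Ring (QSL2 q) := inferInstanceAs (Ring (RingQuot (SL2Rel q)))

instance (q : kˣ) : Algebra k (QSL2 q) := inferInstanceAs (Algebra k (RingQuot (SL2Rel q)))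

/-- The quotient map onto `k_q[SL₂]`. -/
def mkSL2 (q : kˣ) : FreeAlgebra k Idx →ₐ[k] QSL2 q := RingQuot.mkAlgHom k (SL2Rel q)

theorem mkSL2_rel (q : kˣ) {x y : FreeAlgebra k Idx} (h : SL2Rel q x y) :
    mkSL2 q x = mkSL2 q y :=
  RingQuot.mkAlgHom_rel k h

/-- The matrix generators `t^i_j` of `k_q[SL₂]`. -/
def t (q : kˣ) (i j : Fin 2) : QSL2 q := mkSL2 q (freeT k i j)

/-- A family `x i j` in a `k`-algebra that satisfies the relations of `k_q[SL₂]`. -/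
structure IsSL2Family (q : kˣ) {B : Type*} [Ring B] [Algebra k B] (x : Fin 2 → Fin 2 → B) :
    Prop where
  ba : x 0 1 * x 0 0 = (q : k) • (x 0 0 * x 0 1)
  ca : x 1 0 * x 0 0 = (q : k) • (x 0 0 * x 1 0)
  db : x 1 1 * x 0 1 = (q : k) • (x 0 1 * x 1 1)
  dc : x 1 1 * x 1 0 = (q : k) • (x 1 0 * x 1 1)
  bc : x 0 1 * x 1 0 = x 1 0 * x 0 1
  ad : x 0 0 * x 1 1 - (q : k)⁻¹ • (x 0 1 * x 1 0) = 1
  da : x 1 1 * x 0 0 - (q : k) • (x 0 1 * x 1 0) = 1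

/-- Such a family induces an algebra map out of `k_q[SL₂]` with `t^i_j ↦ x i j`. -/
def liftSL2 (q : kˣ) {B : Type*} [Ring B] [Algebra k B] (x : Fin 2 → Fin 2 → B)
    (hx : IsSL2Family q x) : QSL2 q →ₐ[k] B :=
  RingQuot.liftAlgHom k (s := SL2Rel q)
    ⟨FreeAlgebra.lift k (fun p : Idx => x p.1 p.2), by
      obtain ⟨hba, hca, hdb, hdc, hbc, had, hda⟩ := hx
      intro y z h
      cases h <;>
        simp only [freeT, map_mul, map_smul, map_sub, map_one, FreeAlgebra.lift_ι_apply] <;>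
        assumption⟩

theorem liftSL2_t (q : kˣ) {B : Type*} [Ring B] [Algebra k B] (x : Fin 2 → Fin 2 → B)
    (hx : IsSL2Family q x) (i j : Fin 2) : liftSL2 q x hx (t q i j) = x i j := by
  refine (RingQuot.liftAlgHom_mkAlgHom_apply k (s := SL2Rel q) _ _ _).trans ?_
  simp [freeT]

theorem isSL2Family_t (q : kˣ) : IsSL2Family q (t q) where
  ba := by simpa only [t, map_mul, map_smul] using mkSL2_rel q SL2Rel.ba
  ca := by simpa only [t, map_mul, map_smul] using mkSL2_rel q SL2Rel.ca
  db := by simpa only [t, map_mul, map_smul] using mkSL2_rel q SL2Rel.db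
  dc := by simpa only [t, map_mul, map_smul] using mkSL2_rel q SL2Rel.dc
  bc := by simpa only [t, map_mul, map_smul] using mkSL2_rel q SL2Rel.bc
  ad := by simpa only [t, map_mul, map_smul, map_sub, map_one] using mkSL2_rel q SL2Rel.ad
  da := by simpa only [t, map_mul, map_smul, map_sub, map_one] using mkSL2_rel q SL2Rel.da

/-- The matrix `(d, -qb; -q⁻¹c, a)` of a matrix `(a, b; c, d)`. -/
def adj (q : kˣ) {B : Type*} [Ring B] [Algebra k B] (x : Fin 2 → Fin 2 → B) :
    Matrix (Fin 2) (Fin 2) B :=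
  !![x 1 1, -((q : k) • x 0 1); -((q : k)⁻¹ • x 1 0), x 0 0]

theorem isSL2Family_adj (q : kˣ) {B : Type*} [Ring B] [Algebra k B] (x : Fin 2 → Fin 2 → B)
    (hx : IsSL2Family q x) : IsSL2Family q fun i j => MulOpposite.op (adj q x i j) := by
  obtain ⟨hba, hca, hdb, hdc, hbc, had, hda⟩ := hx
  refine ⟨?_, ?_, ?_, ?_, ?_, ?_, ?_⟩ <;> apply MulOpposite.unop_injective
  · simp [adj, hdb, smul_smul]
  · simp [adj, hdc, smul_smul]
  · simp [adj, hba, smul_smul]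
  · simp [adj, hca, smul_smul]
  · simp [adj, hbc, smul_smul]
  · simpa [adj, ← hbc, smul_smul] using had
  · simpa [adj, ← hbc, smul_smul] using hda

/-- The antipode `S` of `k_q[SL₂]`, an antihomomorphism of algebras:
`Sa = d, Sb = -qb, Sc = -q⁻¹c, Sd = a`. -/
def antipode (q : kˣ) : QSL2 q →ₐ[k] (QSL2 q)ᵐᵒᵖ :=
  liftSL2 q (fun i j => MulOpposite.op (adj q (t q) i j)) (isSL2Family_adj q _ (isSL2Family_t q))

/-! ### The right crossed module `Λ¹ = M₂(k)` and its braiding -/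

/-- The `SL₂` R-matrix `R^i_j^k_l`: `R^1_1^1_1 = R^2_2^2_2 = q`, `R^1_1^2_2 = R^2_2^1_1 = 1`,
`R^1_2^2_1 = q - q⁻¹`, all other entries zero. -/
def Rmat (q : kˣ) (i j k' l : Fin 2) : k :=
  if i = j ∧ k' = l then (if i = k' then (q : k) else 1)
  else if i = 0 ∧ j = 1 ∧ k' = 1 ∧ l = 0 then (q : k) - (q : k)⁻¹ else 0

/-- The matrix of the action of a generator on `Λ¹`:
`E_α^β ◁ t^a_b = q⁻¹ ∑ R^m_α^a_c R^c_b^β_n E_m^n`; the entry at `(α, β), (m, n)` is the coefficient of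
`E_m^n`. The factor `q⁻¹` comes from the quantum group normalisation `q^{-1/2} R` of the R-matrix. -/
def actGen (q : kˣ) (a b : Fin 2) : Matrix Idx Idx k :=
  Matrix.of fun p r => (q : k)⁻¹ * ∑ c : Fin 2, Rmat q r.1 p.1 a c * Rmat q c b p.2 r.2

theorem actGen_a (q : kˣ) (p r : Idx) : actGen q 0 0 p r =
    if p = r then (if p = (0, 0) then (q : k) else if p = (1, 1) then (q : k)⁻¹ else 1) else 0 := by
  obtain ⟨i, j⟩ := p
  obtain ⟨m, n⟩ := r
  fin_cases i <;> fin_cases j <;> fin_cases m <;> fin_cases n <;> simp [actGen, Rmat]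

theorem actGen_b (q : kˣ) (p r : Idx) : actGen q 0 1 p r =
    if p = (0, 1) ∧ r = (0, 0) then (q : k) - (q : k)⁻¹
    else if p = (1, 1) ∧ r = (1, 0) then (q : k)⁻¹ * ((q : k) - (q : k)⁻¹) else 0 := by
  obtain ⟨i, j⟩ := p
  obtain ⟨m, n⟩ := r
  fin_cases i <;> fin_cases j <;> fin_cases m <;> fin_cases n <;> simp [actGen, Rmat]

theorem actGen_c (q : kˣ) (p r : Idx) : actGen q 1 0 p r =
    if p = (1, 0) ∧ r = (0, 0) then (q : k) - (q : k)⁻¹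
    else if p = (1, 1) ∧ r = (0, 1) then (q : k)⁻¹ * ((q : k) - (q : k)⁻¹) else 0 := by
  have h0 : (q : k) ≠ 0 := q.ne_zero
  obtain ⟨i, j⟩ := p
  obtain ⟨m, n⟩ := r
  fin_cases i <;> fin_cases j <;> fin_cases m <;> fin_cases n <;> simp [actGen, Rmat, mul_comm, h0]

theorem actGen_d (q : kˣ) (p r : Idx) : actGen q 1 1 p r =
    if p = r then (if p = (0, 0) then (q : k)⁻¹ else if p = (1, 1) then (q : k) else 1)
    else if p = (1, 1) ∧ r = (0, 0) then (q : k)⁻¹ * ((q : k) - (q : k)⁻¹) ^ 2 else 0 := by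
  obtain ⟨i, j⟩ := p
  obtain ⟨m, n⟩ := r
  fin_cases i <;> fin_cases j <;> fin_cases m <;> fin_cases n <;> simp [actGen, Rmat, pow_two]

theorem isSL2Family_actGen (q : kˣ) : IsSL2Family q (actGen q) := by
  have h0 : (q : k) ≠ 0 := q.ne_zero
  constructor <;> ext ⟨i, j⟩ ⟨m, n⟩ <;>
    simp only [Matrix.sub_apply, Matrix.smul_apply, Matrix.mul_apply, Fintype.sum_prod_type,
      Fin.sum_univ_two, actGen_a, actGen_b, actGen_c, actGen_d] <;>
    fin_cases i <;> fin_cases j <;> fin_cases m <;> fin_cases n <;>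
    simp <;> (try field_simp) <;> (try ring)

/-- The right action of `A` on `Λ¹`, in row vector form: `e_i ◁ x = ∑ j, (act q x) i j • e_j`. -/
def act (q : kˣ) : QSL2 q →ₐ[k] Matrix Idx Idx k :=
  liftSL2 q (actGen q) (isSL2Family_actGen q)

/-- The right coaction of `A` on `Λ¹`, `Δ_R E_α^β = ∑ E_m^n ⊗ t^m_α S(t^β_n)`: the component of
`Δ_R e_j` along `e_i`, so that `Δ_R e_j = ∑ i, e_i ⊗ coact q i j`. -/
def coact (q : kˣ) (i j : Idx) : QSL2 q :=
  t q i.1 j.1 * (antipode q (t q j.2 i.2)).unop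

/-- The crossed module braiding `Ψ(v ⊗ w) = w_(0) ⊗ v ◁ w_(1)` of `Λ¹`: the coefficient of
`e_m ⊗ e_n` in `Ψ(e_i ⊗ e_j)`. -/
def braiding (q : kˣ) (m n i j : Idx) : k := act q (coact q m j) i n

/-! ### Braided factorials and the braided exterior algebra `Λ = B₋(Λ¹)` -/

/-- The tensor power `V^{⊗ m}` of the vector space `V` with basis `e_i`, `i : Idx`, as arrays of
coefficients: `f` stands for `∑ w, f w • e_{w 0} ⊗ ⋯ ⊗ e_{w (m-1)}`. -/
abbrev Tens (k : Type*) (m : ℕ) : Type _ := (Fin m → Idx) → k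

/-- `id ⊗ X` on `V ⊗ V^{⊗ m}`. -/
def idTensor {m : ℕ} (X : Tens k m →ₗ[k] Tens k m) : Tens k (m + 1) →ₗ[k] Tens k (m + 1) where
  toFun f w := X (fun v => f (Fin.cons (w 0) v)) (Fin.tail w)
  map_add' f g := by
    funext w
    exact congrFun (X.map_add (fun v => f (Fin.cons (w 0) v)) fun v => g (Fin.cons (w 0) v)) _
  map_smul' c f := by
    funext w
    exact congrFun (X.map_smul c fun v => f (Fin.cons (w 0) v)) _

/-- For `Φ : V ⊗ V → V ⊗ V` with `Φ(e_i ⊗ e_j) = ∑ Φ m n i j • e_m ⊗ e_n`, the operator `Φ₁` that acts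
by `Φ` in the first two tensor factors. -/
def firstTwo (Φ : Idx → Idx → Idx → Idx → k) (m : ℕ) : Tens k (m + 2) →ₗ[k] Tens k (m + 2) where
  toFun f w := ∑ i : Idx, ∑ j : Idx,
    Φ (w 0) (w 1) i j * f (Fin.cons i (Fin.cons j (Fin.tail (Fin.tail w))))
  map_add' f g := by
    funext w
    simp [mul_add, Finset.sum_add_distrib]
  map_smul' c f := by
    funext w
    simp [Finset.mul_sum, mul_left_comm]

/-- The braided integer `[m, Φ] = id + Φ₁ + Φ₁Φ₂ + ⋯ + Φ₁Φ₂⋯Φ_{m-1} = id + Φ₁ (id ⊗ [m-1, Φ])`. -/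
def braidedInt (Φ : Idx → Idx → Idx → Idx → k) : (m : ℕ) → Tens k m →ₗ[k] Tens k m
  | 0 => LinearMap.id
  | 1 => LinearMap.id
  | m + 2 => LinearMap.id + firstTwo Φ m ∘ₗ idTensor (braidedInt Φ (m + 1))

/-- The braided factorial `[m, Φ]! = (id ⊗ [m-1, Φ]!) [m, Φ]`. -/
def braidedFact (Φ : Idx → Idx → Idx → Idx → k) : (m : ℕ) → Tens k m →ₗ[k] Tens k m
  | 0 => LinearMap.id
  | m + 1 => idTensor (braidedFact Φ m) ∘ₗ braidedInt Φ (m + 1)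

/-- The inclusion of `V^{⊗ m}` in the tensor algebra of `V`, that is, in the free algebra on the
basis of `V`. -/
def toFree (k : Type*) [Field k] (m : ℕ) : Tens k m →ₗ[k] FreeAlgebra k Idx :=
  Fintype.linearCombination k
    (fun w : Fin m → Idx => (List.ofFn fun i => FreeAlgebra.ι k (w i)).prod)

/-- The relations of `B₋(Λ¹)`: every element of `ker [m, -Ψ]!` is set to zero, for every `m`. -/
inductive ExtRel (q : kˣ) : FreeAlgebra k Idx → FreeAlgebra k Idx → Prop
  | ker (m : ℕ) (x : Tens k m) (hx : braidedFact (-braiding q) m x = 0) : ExtRel q (toFree k m x) 0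

/-- The braided exterior algebra `Λ = B₋(Λ¹) = T Λ¹ / ⊕ₘ ker [m, -Ψ]!`. -/
def ExtAlg (q : kˣ) : Type _ := RingQuot (ExtRel q)

instance (q : kˣ) : Ring (ExtAlg q) := inferInstanceAs (Ring (RingQuot (ExtRel q)))

instance (q : kˣ) : Algebra k (ExtAlg q) := inferInstanceAs (Algebra k (RingQuot (ExtRel q)))

/-- The quotient map from the tensor algebra onto `Λ`. -/
def mkExt (q : kˣ) : FreeAlgebra k Idx →ₐ[k] ExtAlg q := RingQuot.mkAlgHom k (ExtRel q)

/-- The projection `V^{⊗ m} → Λ`. -/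
def proj (q : kˣ) (m : ℕ) : Tens k m →ₗ[k] ExtAlg q := (mkExt q).toLinearMap ∘ₗ toFree k m

/-- The component `Λ^m` of degree `m`. -/
def extDeg (q : kˣ) (m : ℕ) : Submodule k (ExtAlg q) := LinearMap.range (proj q m)

/-- The basis elements `E_α^β` of `Λ¹` inside `Λ`. -/
def e (q : kˣ) (i : Idx) : ExtAlg q := mkExt q (FreeAlgebra.ι k i)

/-- `e_a = E_1^1`. -/
def ea (q : kˣ) : ExtAlg q := e q (0, 0)

/-- `e_b = E_1^2`. -/
def eb (q : kˣ) : ExtAlg q := e q (0, 1)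

/-- `e_c = E_2^1`. -/
def ec (q : kˣ) : ExtAlg q := e q (1, 0)

/-- `e_d = E_2^2`. -/
def ed (q : kˣ) : ExtAlg q := e q (1, 1)

/-- The top form `Vol = e_a e_b e_c e_d`. -/
def vol (q : kˣ) : ExtAlg q := ea q * eb q * ec q * ed q

/-! ### The metric, the element `exp`, the integral and the Hodge star -/

/-- The coordinate vector of `e_z = q⁻² e_a - e_d` in `Λ¹`. -/
def zVec (q : kˣ) : Idx → k := ((q : k) ^ 2)⁻¹ • Pi.single (0, 0) 1 - Pi.single (1, 1) 1

/-- The coordinate vector of `θ = e_a + e_d` in `Λ¹`. -/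
def thetaVec (k : Type*) [Field k] : Idx → k := Pi.single (0, 0) 1 + Pi.single (1, 1) 1

/-- The bi-invariant central metric
`g = e_c ⊗ e_b + q² e_b ⊗ e_c + q³ / (q + q⁻¹) (e_z ⊗ e_z - θ ⊗ θ)`: the coefficient of `e_i ⊗ e_j`. -/
def metric (q : kˣ) (i j : Idx) : k :=
  (Pi.single (1, 0) 1 : Idx → k) i * (Pi.single (0, 1) 1 : Idx → k) j
    + (q : k) ^ 2 * ((Pi.single (0, 1) 1 : Idx → k) i * (Pi.single (1, 0) 1 : Idx → k) j)
    + (q : k) ^ 3 / ((q : k) + (q : k)⁻¹) * (zVec q i * zVec q j - thetaVec k i * thetaVec k j)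

/-- The nested coevaluation of `V^{⊗ m}`, `∑ e_{a₁} ⊗ ⋯ ⊗ e_{aₘ} ⊗ f^{aₘ} ⊗ ⋯ ⊗ f^{a₁}`, with the
dual `V^*` (dual basis `f^a`) identified with `V` by the metric, `f^a ↦ ∑ b, g^{ab} e_b`. -/
def coevMetric (q : kˣ) (m : ℕ) : Tens k m ⊗[k] Tens k m :=
  ∑ w : Fin m → Idx, ∑ v : Fin m → Idx,
    (∏ i : Fin m, metric q (w i) (v i.rev)) •
      ((Pi.single w 1 : Tens k m) ⊗ₜ[k] (Pi.single v 1 : Tens k m))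

/-- `E` is the degree `m` component `([m, -Ψ]!⁻¹ ⊗ id) coev` of `exp`, as an element of `Λ ⊗ Λ`: the
inverse image under `[m, -Ψ]!` is any `X` that is mapped to `coev` modulo the relations of the second
factor. -/
def IsExpDeg (q : kˣ) (m : ℕ) (E : ExtAlg q ⊗[k] ExtAlg q) : Prop :=
  ∃ X : Tens k m ⊗[k] Tens k m,
    TensorProduct.map (braidedFact (-braiding q) m) (proj q m) X =
        TensorProduct.map LinearMap.id (proj q m) (coevMetric q m) ∧
      TensorProduct.map (proj q m) (proj q m) X = E

/-- The degree `m` component of `exp`. -/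
def expDeg (q : kˣ) (m : ℕ) : ExtAlg q ⊗[k] ExtAlg q := Classical.epsilon (IsExpDeg q m)

/-- The coevaluation element `exp ∈ Λ ⊗ Λ` (the top degree is `4`). -/
def exp (q : kˣ) : ExtAlg q ⊗[k] ExtAlg q := ∑ m ∈ Finset.range 5, expDeg q m

/-- `I` is the integral on `Λ`: `∫ Vol = 1`, and `∫` vanishes outside the top degree `4`. -/
def IsExtIntegral (q : kˣ) (I : ExtAlg q →ₗ[k] k) : Prop :=
  I (vol q) = 1 ∧ ∀ m : ℕ, m ≠ 4 → ∀ ω ∈ extDeg q m, I ω = 0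

/-- The integral `∫ : Λ → k`. -/
def integral (q : kˣ) : ExtAlg q →ₗ[k] k := Classical.epsilon (IsExtIntegral q)

/-- The constant `μ = (∫ ⊗ ∫) exp`. -/
def mu (q : kˣ) : k := TensorProduct.lid k k (TensorProduct.map (integral q) (integral q) (exp q))

/-- The Hodge star `♯ : Λ → Λ`: the super-braided Fourier transform `ω ↦ (∫ ⊗ id)(ω exp)`, with its
values in `B₋(Λ¹^*)` identified with `Λ` by the metric (as in `coevMetric`). -/
def sharp (q : kˣ) : ExtAlg q →ₗ[k] ExtAlg q where
  toFun ω := TensorProduct.lid k (ExtAlg q)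
    (TensorProduct.map (integral q ∘ₗ LinearMap.mulLeft k ω) LinearMap.id (exp q))
  map_add' ω η := by
    have h : LinearMap.mulLeft k (ω + η) = LinearMap.mulLeft k ω + LinearMap.mulLeft k η :=
      LinearMap.ext fun x => add_mul ω η x
    rw [h, LinearMap.comp_add, TensorProduct.map_add_left, LinearMap.add_apply, map_add]
  map_smul' c ω := by
    have h : LinearMap.mulLeft k (c • ω) = c • LinearMap.mulLeft k ω :=
      LinearMap.ext fun x => smul_mul_assoc c ω x
    rw [h, LinearMap.comp_smul, TensorProduct.map_smul_left, LinearMap.smul_apply, map_smul]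
    rfl

/-- The forms of degree `m` on `A`, `Ω^m = A ⊗ Λ^m`, inside `Ω = A ⊗ Λ`. -/
def omegaDeg (q : kˣ) (m : ℕ) : Submodule k (QSL2 q ⊗[k] ExtAlg q) :=
  LinearMap.range (LinearMap.lTensor (QSL2 q) (extDeg q m).subtype)

/-- The extension of `♯` to the exterior algebra `Ω = A ⊗ Λ` on `A` (the bosonisation of `Λ`), as a
left `A`-module map: `♯(x ω) = x ♯ω`. -/
def sharpOmega (q : kˣ) : QSL2 q ⊗[k] ExtAlg q →ₗ[k] QSL2 q ⊗[k] ExtAlg q :=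
  LinearMap.lTensor (QSL2 q) (sharp q)

/-- The normalised Hodge star `♯' = q⁻³ ♯` on `Λ`. -/
def sharpNorm (q : kˣ) : ExtAlg q →ₗ[k] ExtAlg q := ((q : k) ^ 3)⁻¹ • sharp q

/-- The normalised Hodge star `♯' = q⁻³ ♯` on `Ω`. -/
def sharpOmegaNorm (q : kˣ) : QSL2 q ⊗[k] ExtAlg q →ₗ[k] QSL2 q ⊗[k] ExtAlg q :=
  ((q : k) ^ 3)⁻¹ • sharpOmega q

/-- `λ = 1 - q⁻²`. -/
def lam (q : kˣ) : k := 1 - ((q : k) ^ 2)⁻¹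

end

end QHodge

open QHodge

namespace QHodge

noncomputable section

variable {k : Type*} [Field k]

/-! ### A sixteen-dimensional model of `Λ` -/

/-! Everything is transported to an explicit model: the sixteen ordered monomials, with matrices for
left and right multiplication by the $e_i$ and for the braided derivations $\partial_i$. The bridge
to the abstract definition is the braided Leibniz rule
$\partial_m(e_jb)=\delta_{mj}b-\sum\Psi^{mn}{}_{ji}\,e_n\,\partial_ib$ (`bder_leftMul`). By
induction, the slice of $[m,-\Psi]f$ at first letter $i$ maps to $\partial_i$ of the image of $f$
(`bder_toModel`), so $[m,-\Psi]!$ factors through the model. Since the $\partial_i$ have no common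
kernel in positive degree, the kernel of $V^{\otimes m}\to$ model is exactly $\ker[m,-\Psi]!$
(`toModel_eq_zero_iff`). Hence $\Lambda$ is isomorphic to the model (`coords`, `ofCoords`), which
gives the dimensions and the integral.

For $\exp$, the matrix `expMat` turns the transpose of $\partial_i$ into right multiplication by
$\sum_jg^{ij}e_j$ (`expMat_bderDual`). Applied letter by letter, this shows that $\exp$ is the sum
over $K$ of the $K$-th monomial tensored with the image of the $K$-th basis vector under `expMat`
(`exp_eq`). Pairing with the top coordinate makes $\sharp$ the matrix `hodge`; the table and the
quadratic relations are then matrix identities, and tensoring with $A$ extends the relations to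
$\Omega$. -/

/-- The vector space with basis the ordered monomials
`1, e_a, e_b, e_c, e_d, e_a e_b, e_a e_c, e_a e_d, e_b e_c, e_b e_d, e_c e_d, e_a e_b e_c, e_a e_b e_d,
e_a e_c e_d, e_b e_c e_d, e_a e_b e_c e_d`, in this order. -/
abbrev Model (k : Type*) : Type _ := Fin 16 → k

/-- The degrees of the sixteen ordered monomials. -/
def monDeg : Fin 16 → ℕ := ![0, 1, 1, 1, 1, 2, 2, 2, 2, 2, 2, 3, 3, 3, 3, 4]

/-- The coordinates on the model. -/
abbrev ξ (i : Fin 16) : Model k →ₗ[k] k := LinearMap.proj i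

/-- Left multiplication by `e_i` on the model. -/
def leftMul (q : kˣ) : Idx → Model k →ₗ[k] Model k
  | (0, 0) => LinearMap.pi
    ![0, ξ 0, 0, 0, 0, ξ 2, ξ 3, ξ 4, 0, 0, 0, ξ 8, ξ 9, ξ 10, 0, ξ 14]
  | (0, 1) => LinearMap.pi
    ![0, 0, ξ 0, 0, 0, -ξ 1, 0, 0, ξ 3, ξ 4, 0, -ξ 6, -ξ 7, 0, ξ 10, -ξ 13]
  | (1, 0) => LinearMap.pi
    ![0, 0, 0, ξ 0, 0, 0, -ξ 1, 0, -ξ 2, 0, ξ 4, ξ 5, 0, -ξ 7, -ξ 9, ξ 12]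
  | (1, 1) => LinearMap.pi
    ![0, 0, 0, 0, ξ 0, ((q : k)⁻¹ ^ 2 - (q : k)⁻¹ ^ 4) • ξ 2, ((q : k)⁻¹ ^ 2 - 1) • ξ 3, -ξ 1,
      (1 - (q : k)⁻¹ ^ 2) • ξ 1 + ((q : k)⁻¹ ^ 2 - 1) • ξ 4, -(q : k)⁻¹ ^ 2 • ξ 2,
      -(q : k) ^ 2 • ξ 3, (1 - (q : k)⁻¹ ^ 2) • ξ 7,
      (q : k)⁻¹ ^ 2 • ξ 5 + ((q : k)⁻¹ ^ 2 - (q : k)⁻¹ ^ 4) • ξ 9,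
      (q : k) ^ 2 • ξ 6 + ((q : k)⁻¹ ^ 2 - 1) • ξ 10, (1 - (q : k)⁻¹ ^ 2) • ξ 7 + ξ 8, -ξ 11]

theorem leftMul_a (q : kˣ) (b : Model k) : leftMul q (0, 0) b =
    ![0, b 0, 0, 0, 0, b 2, b 3, b 4, 0, 0, 0, b 8, b 9, b 10, 0, b 14] := by
  ext K
  fin_cases K <;> rfl

theorem leftMul_b (q : kˣ) (b : Model k) : leftMul q (0, 1) b =
    ![0, 0, b 0, 0, 0, -b 1, 0, 0, b 3, b 4, 0, -b 6, -b 7, 0, b 10, -b 13] := by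
  ext K
  fin_cases K <;> rfl

theorem leftMul_c (q : kˣ) (b : Model k) : leftMul q (1, 0) b =
    ![0, 0, 0, b 0, 0, 0, -b 1, 0, -b 2, 0, b 4, b 5, 0, -b 7, -b 9, b 12] := by
  ext K
  fin_cases K <;> rfl

theorem leftMul_d (q : kˣ) (b : Model k) : leftMul q (1, 1) b =
    ![0, 0, 0, 0, b 0, ((q : k)⁻¹ ^ 2 - (q : k)⁻¹ ^ 4) * b 2, ((q : k)⁻¹ ^ 2 - 1) * b 3, -b 1,
      (1 - (q : k)⁻¹ ^ 2) * b 1 + ((q : k)⁻¹ ^ 2 - 1) * b 4, -(q : k)⁻¹ ^ 2 * b 2,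
      -(q : k) ^ 2 * b 3, (1 - (q : k)⁻¹ ^ 2) * b 7,
      (q : k)⁻¹ ^ 2 * b 5 + ((q : k)⁻¹ ^ 2 - (q : k)⁻¹ ^ 4) * b 9,
      (q : k) ^ 2 * b 6 + ((q : k)⁻¹ ^ 2 - 1) * b 10, (1 - (q : k)⁻¹ ^ 2) * b 7 + b 8, -b 11] := by
  ext K
  fin_cases K <;> rfl

/-- Right multiplication by `e_i` on the model. -/
def rightMul (q : kˣ) : Idx → Model k →ₗ[k] Model k
  | (0, 0) => LinearMap.pi
    ![0, ξ 0, 0, 0, 0, -ξ 2, -ξ 3, -ξ 4, (1 - (q : k)⁻¹ ^ 2) • ξ 4, 0, 0,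
      (1 - (q : k)⁻¹ ^ 2) • ξ 7 + ξ 8, ξ 9, ξ 10, 0, -ξ 14]
  | (0, 1) => LinearMap.pi
    ![0, 0, ξ 0, 0, 0, ξ 1 + ((q : k)⁻¹ ^ 2 - (q : k)⁻¹ ^ 4) • ξ 4, 0, 0, -ξ 3,
      -(q : k)⁻¹ ^ 2 • ξ 4, 0, -ξ 6 + ((q : k)⁻¹ ^ 2 - (q : k)⁻¹ ^ 4) • ξ 10,
      -(q : k)⁻¹ ^ 2 • ξ 7, 0, (q : k)⁻¹ ^ 2 • ξ 10, (q : k)⁻¹ ^ 2 • ξ 13]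
  | (1, 0) => LinearMap.pi
    ![0, 0, 0, ξ 0, 0, 0, ξ 1 + ((q : k)⁻¹ ^ 2 - 1) • ξ 4, 0, ξ 2, 0, -(q : k) ^ 2 • ξ 4,
      ξ 5 + (1 - (q : k)⁻¹ ^ 2) • ξ 9, 0, -(q : k) ^ 2 • ξ 7, -(q : k) ^ 2 • ξ 9,
      -(q : k) ^ 2 • ξ 12]
  | (1, 1) => LinearMap.pi
    ![0, 0, 0, 0, ξ 0, 0, 0, ξ 1, ((q : k)⁻¹ ^ 2 - 1) • ξ 4, ξ 2, ξ 3, ((q : k)⁻¹ ^ 2 - 1) • ξ 7,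
      ξ 5, ξ 6, ξ 8, ξ 11]

theorem rightMul_a (q : kˣ) (b : Model k) : rightMul q (0, 0) b =
    ![0, b 0, 0, 0, 0, -b 2, -b 3, -b 4, (1 - (q : k)⁻¹ ^ 2) * b 4, 0, 0,
      (1 - (q : k)⁻¹ ^ 2) * b 7 + b 8, b 9, b 10, 0, -b 14] := by
  ext K
  fin_cases K <;> rfl

theorem rightMul_b (q : kˣ) (b : Model k) : rightMul q (0, 1) b =
    ![0, 0, b 0, 0, 0, b 1 + ((q : k)⁻¹ ^ 2 - (q : k)⁻¹ ^ 4) * b 4, 0, 0, -b 3,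
      -(q : k)⁻¹ ^ 2 * b 4, 0, -b 6 + ((q : k)⁻¹ ^ 2 - (q : k)⁻¹ ^ 4) * b 10,
      -(q : k)⁻¹ ^ 2 * b 7, 0, (q : k)⁻¹ ^ 2 * b 10, (q : k)⁻¹ ^ 2 * b 13] := by
  ext K
  fin_cases K <;> rfl

theorem rightMul_c (q : kˣ) (b : Model k) : rightMul q (1, 0) b =
    ![0, 0, 0, b 0, 0, 0, b 1 + ((q : k)⁻¹ ^ 2 - 1) * b 4, 0, b 2, 0, -(q : k) ^ 2 * b 4,
      b 5 + (1 - (q : k)⁻¹ ^ 2) * b 9, 0, -(q : k) ^ 2 * b 7, -(q : k) ^ 2 * b 9,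
      -(q : k) ^ 2 * b 12] := by
  ext K
  fin_cases K <;> rfl

theorem rightMul_d (q : kˣ) (b : Model k) : rightMul q (1, 1) b =
    ![0, 0, 0, 0, b 0, 0, 0, b 1, ((q : k)⁻¹ ^ 2 - 1) * b 4, b 2, b 3, ((q : k)⁻¹ ^ 2 - 1) * b 7,
      b 5, b 6, b 8, b 11] := by
  ext K
  fin_cases K <;> rfl

/-- The braided derivations `∂_i` on the model, dual to `[m, -Ψ]`. -/
def bder (q : kˣ) : Idx → Model k →ₗ[k] Model k
  | (0, 0) => LinearMap.pi
    ![ξ 1, ((q : k)⁻¹ ^ 2 - 1) • ξ 8, ξ 5, ξ 6, ξ 7, 0, 0, ((q : k)⁻¹ ^ 2 - 1) • ξ 14, ξ 11,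
      ξ 12, ξ 13, 0, 0, 0, ξ 15, 0]
  | (0, 1) => LinearMap.pi
    ![ξ 2, -(q : k) ^ 2 • ξ 5 + (1 - (q : k) ^ 2) • ξ 9, 0, ξ 8, ξ 9, 0,
      -(q : k) ^ 2 • ξ 11 + ((q : k) ^ 2 - 1) • ξ 14, -(q : k) ^ 2 • ξ 12, 0, 0, ξ 14, 0, 0,
      -(q : k) ^ 2 • ξ 15, 0, 0]
  | (1, 0) => LinearMap.pi
    ![ξ 3, -(q : k)⁻¹ ^ 2 • ξ 6 + (1 - (q : k)⁻¹ ^ 2) • ξ 10, -ξ 8, 0, ξ 10,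
      (q : k)⁻¹ ^ 2 • ξ 11 + (1 - (q : k)⁻¹ ^ 2) • ξ 14, 0, -(q : k)⁻¹ ^ 2 • ξ 13, 0, -ξ 14, 0,
      0, (q : k)⁻¹ ^ 2 • ξ 15, 0, 0, 0]
  | (1, 1) => LinearMap.pi
    ![ξ 4, -ξ 7 + ((q : k) ^ 2 - 1) • ξ 8, -ξ 9, -ξ 10, 0, ξ 12, ξ 13, ((q : k) ^ 2 - 1) • ξ 14,
      ξ 14, 0, 0, -ξ 15, 0, 0, 0, 0]

theorem bder_a (q : kˣ) (b : Model k) : bder q (0, 0) b =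
    ![b 1, ((q : k)⁻¹ ^ 2 - 1) * b 8, b 5, b 6, b 7, 0, 0, ((q : k)⁻¹ ^ 2 - 1) * b 14, b 11,
      b 12, b 13, 0, 0, 0, b 15, 0] := by
  ext K
  fin_cases K <;> rfl

theorem bder_b (q : kˣ) (b : Model k) : bder q (0, 1) b =
    ![b 2, -(q : k) ^ 2 * b 5 + (1 - (q : k) ^ 2) * b 9, 0, b 8, b 9, 0,
      -(q : k) ^ 2 * b 11 + ((q : k) ^ 2 - 1) * b 14, -(q : k) ^ 2 * b 12, 0, 0, b 14, 0, 0,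
      -(q : k) ^ 2 * b 15, 0, 0] := by
  ext K
  fin_cases K <;> rfl

theorem bder_c (q : kˣ) (b : Model k) : bder q (1, 0) b =
    ![b 3, -(q : k)⁻¹ ^ 2 * b 6 + (1 - (q : k)⁻¹ ^ 2) * b 10, -b 8, 0, b 10,
      (q : k)⁻¹ ^ 2 * b 11 + (1 - (q : k)⁻¹ ^ 2) * b 14, 0, -(q : k)⁻¹ ^ 2 * b 13, 0, -b 14, 0,
      0, (q : k)⁻¹ ^ 2 * b 15, 0, 0, 0] := by
  ext K
  fin_cases K <;> rfl

theorem bder_d (q : kˣ) (b : Model k) : bder q (1, 1) b =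
    ![b 4, -b 7 + ((q : k) ^ 2 - 1) * b 8, -b 9, -b 10, 0, b 12, b 13, ((q : k) ^ 2 - 1) * b 14,
      b 14, 0, 0, -b 15, 0, 0, 0, 0] := by
  ext K
  fin_cases K <;> rfl

/-- The transposes of the braided derivations. -/
def bderDual (q : kˣ) : Idx → Model k →ₗ[k] Model k
  | (0, 0) => LinearMap.pi
    ![0, ξ 0, 0, 0, 0, ξ 2, ξ 3, ξ 4, ((q : k)⁻¹ ^ 2 - 1) • ξ 1, 0, 0, ξ 8, ξ 9, ξ 10,
      ((q : k)⁻¹ ^ 2 - 1) • ξ 7, ξ 14]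
  | (0, 1) => LinearMap.pi
    ![0, 0, ξ 0, 0, 0, -(q : k) ^ 2 • ξ 1, 0, 0, ξ 3, (1 - (q : k) ^ 2) • ξ 1 + ξ 4, 0,
      -(q : k) ^ 2 • ξ 6, -(q : k) ^ 2 • ξ 7, 0, ((q : k) ^ 2 - 1) • ξ 6 + ξ 10,
      -(q : k) ^ 2 • ξ 13]
  | (1, 0) => LinearMap.pi
    ![0, 0, 0, ξ 0, 0, 0, -(q : k)⁻¹ ^ 2 • ξ 1, 0, -ξ 2, 0, (1 - (q : k)⁻¹ ^ 2) • ξ 1 + ξ 4,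
      (q : k)⁻¹ ^ 2 • ξ 5, 0, -(q : k)⁻¹ ^ 2 • ξ 7, (1 - (q : k)⁻¹ ^ 2) • ξ 5 - ξ 9,
      (q : k)⁻¹ ^ 2 • ξ 12]
  | (1, 1) => LinearMap.pi
    ![0, 0, 0, 0, ξ 0, 0, 0, -ξ 1, ((q : k) ^ 2 - 1) • ξ 1, -ξ 2, -ξ 3, 0, ξ 5, ξ 6,
      ((q : k) ^ 2 - 1) • ξ 7 + ξ 8, -ξ 11]

theorem bderDual_a (q : kˣ) (b : Model k) : bderDual q (0, 0) b =
    ![0, b 0, 0, 0, 0, b 2, b 3, b 4, ((q : k)⁻¹ ^ 2 - 1) * b 1, 0, 0, b 8, b 9, b 10,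
      ((q : k)⁻¹ ^ 2 - 1) * b 7, b 14] := by
  ext K
  fin_cases K <;> rfl

theorem bderDual_b (q : kˣ) (b : Model k) : bderDual q (0, 1) b =
    ![0, 0, b 0, 0, 0, -(q : k) ^ 2 * b 1, 0, 0, b 3, (1 - (q : k) ^ 2) * b 1 + b 4, 0,
      -(q : k) ^ 2 * b 6, -(q : k) ^ 2 * b 7, 0, ((q : k) ^ 2 - 1) * b 6 + b 10,
      -(q : k) ^ 2 * b 13] := by
  ext K
  fin_cases K <;> rfl

theorem bderDual_c (q : kˣ) (b : Model k) : bderDual q (1, 0) b =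
    ![0, 0, 0, b 0, 0, 0, -(q : k)⁻¹ ^ 2 * b 1, 0, -b 2, 0, (1 - (q : k)⁻¹ ^ 2) * b 1 + b 4,
      (q : k)⁻¹ ^ 2 * b 5, 0, -(q : k)⁻¹ ^ 2 * b 7, (1 - (q : k)⁻¹ ^ 2) * b 5 - b 9,
      (q : k)⁻¹ ^ 2 * b 12] := by
  ext K
  fin_cases K <;> rfl

theorem bderDual_d (q : kˣ) (b : Model k) : bderDual q (1, 1) b =
    ![0, 0, 0, 0, b 0, 0, 0, -b 1, ((q : k) ^ 2 - 1) * b 1, -b 2, -b 3, 0, b 5, b 6,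
      ((q : k) ^ 2 - 1) * b 7 + b 8, -b 11] := by
  ext K
  fin_cases K <;> rfl

/-- The coefficients of `exp`: the image of the `I`-th basis vector is the second factor that
accompanies the `I`-th monomial. -/
def expMat (q : kˣ) : Model k →ₗ[k] Model k :=
  LinearMap.pi
    ![ξ 0, (1 - (q : k) ^ 2) • ξ 1 - (q : k) ^ 2 • ξ 4, ξ 3, (q : k) ^ 2 • ξ 2,
      -(q : k) ^ 2 • ξ 1, ((q : k) ^ 2 - 1) • ξ 6 - (q : k) ^ 2 • ξ 10,
      ((q : k) ^ 4 - (q : k) ^ 2) • ξ 5 - (q : k) ^ 4 • ξ 9, (q : k) ^ 4 • ξ 7,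
      (q : k) ^ 2 • ξ 8, -(q : k) ^ 2 • ξ 6, -(q : k) ^ 4 • ξ 5,
      ((q : k) ^ 2 - (q : k) ^ 4) • ξ 11 - (q : k) ^ 4 • ξ 14, (q : k) ^ 4 • ξ 13,
      (q : k) ^ 6 • ξ 12, -(q : k) ^ 4 • ξ 11, (q : k) ^ 6 • ξ 15]

theorem expMat_apply (q : kˣ) (b : Model k) : expMat q b =
    ![b 0, (1 - (q : k) ^ 2) * b 1 - (q : k) ^ 2 * b 4, b 3, (q : k) ^ 2 * b 2,
      -(q : k) ^ 2 * b 1, ((q : k) ^ 2 - 1) * b 6 - (q : k) ^ 2 * b 10,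
      ((q : k) ^ 4 - (q : k) ^ 2) * b 5 - (q : k) ^ 4 * b 9, (q : k) ^ 4 * b 7,
      (q : k) ^ 2 * b 8, -(q : k) ^ 2 * b 6, -(q : k) ^ 4 * b 5,
      ((q : k) ^ 2 - (q : k) ^ 4) * b 11 - (q : k) ^ 4 * b 14, (q : k) ^ 4 * b 13,
      (q : k) ^ 6 * b 12, -(q : k) ^ 4 * b 11, (q : k) ^ 6 * b 15] := by
  ext K
  fin_cases K <;> rfl

/-- The Hodge star on the model. -/
def hodge (q : kˣ) : Model k →ₗ[k] Model k :=
  LinearMap.pi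
    ![ξ 15, -(q : k) ^ 2 • ξ 11 + ((q : k) ^ 2 - 1) • ξ 14, -(q : k) ^ 2 • ξ 12, ξ 13,
      (q : k) ^ 2 • ξ 14, -(q : k) ^ 2 • ξ 5 + (1 - (q : k) ^ 4) • ξ 9, (q : k) ^ 4 • ξ 6,
      ((q : k) ^ 4 - (q : k) ^ 2) • ξ 7 + (q : k) ^ 4 • ξ 8, (q : k) ^ 2 • ξ 7,
      (q : k) ^ 4 • ξ 9, -(q : k) ^ 2 • ξ 10,
      -(q : k) ^ 4 • ξ 1 + ((q : k) ^ 4 - (q : k) ^ 2) • ξ 4, -(q : k) ^ 4 • ξ 2,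
      (q : k) ^ 6 • ξ 3, (q : k) ^ 4 • ξ 4, (q : k) ^ 6 • ξ 0]

theorem hodge_apply (q : kˣ) (b : Model k) : hodge q b =
    ![b 15, -(q : k) ^ 2 * b 11 + ((q : k) ^ 2 - 1) * b 14, -(q : k) ^ 2 * b 12, b 13,
      (q : k) ^ 2 * b 14, -(q : k) ^ 2 * b 5 + (1 - (q : k) ^ 4) * b 9, (q : k) ^ 4 * b 6,
      ((q : k) ^ 4 - (q : k) ^ 2) * b 7 + (q : k) ^ 4 * b 8, (q : k) ^ 2 * b 7,
      (q : k) ^ 4 * b 9, -(q : k) ^ 2 * b 10,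
      -(q : k) ^ 4 * b 1 + ((q : k) ^ 4 - (q : k) ^ 2) * b 4, -(q : k) ^ 4 * b 2,
      (q : k) ^ 6 * b 3, (q : k) ^ 4 * b 4, (q : k) ^ 6 * b 0] := by
  ext K
  fin_cases K <;> rfl

/-! ### The braiding in coordinates. -/

theorem act_t (q : kˣ) (i j : Fin 2) : act q (t q i j) = actGen q i j :=
  liftSL2_t q (actGen q) (isSL2Family_actGen q) i j

theorem antipode_t (q : kˣ) (i j : Fin 2) : (antipode q (t q i j)).unop = adj q (t q) i j := by
  rw [antipode, liftSL2_t, MulOpposite.unop_op]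

theorem act_adj (q : kˣ) (i j : Fin 2) : act q (adj q (t q) i j) = adj q (actGen q) i j := by
  fin_cases i <;> fin_cases j <;> simp [adj, act_t]

/-- The action is an algebra map and the antipode is known on generators, so each coefficient of
$\Psi$ is an entry of a product of two explicit $4\times4$ matrices; no computation inside $A$
remains. -/
theorem braiding_eq (q : kˣ) (m n i j : Idx) :
    braiding q m n i j = (actGen q m.1 j.1 * adj q (actGen q) j.2 m.2) i n := by
  rw [braiding, coact, map_mul, act_t, antipode_t, act_adj]

theorem adj_a (q : kˣ) {B : Type*} [Ring B] [Algebra k B] (x : Fin 2 → Fin 2 → B) :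
    adj q x 0 0 = x 1 1 := rfl

theorem adj_b (q : kˣ) {B : Type*} [Ring B] [Algebra k B] (x : Fin 2 → Fin 2 → B) :
    adj q x 0 1 = -((q : k) • x 0 1) := rfl

theorem adj_c (q : kˣ) {B : Type*} [Ring B] [Algebra k B] (x : Fin 2 → Fin 2 → B) :
    adj q x 1 0 = -((q : k)⁻¹ • x 1 0) := rfl

theorem adj_d (q : kˣ) {B : Type*} [Ring B] [Algebra k B] (x : Fin 2 → Fin 2 → B) :
    adj q x 1 1 = x 0 0 := rfl

/-- The nonzero entries of the braiding, in the form of sums over the inner indices. -/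
theorem sum_braiding (q : kˣ) {M : Type*} [AddCommGroup M] [Module k M] (F : Idx → Idx → M) :
    (∑ n, ∑ i, braiding q (0, 0) n (0, 0) i • F n i =
      F (0, 0) (0, 0)) ∧
    (∑ n, ∑ i, braiding q (0, 0) n (0, 1) i • F n i =
      (1 - (q : k)⁻¹ ^ 2) • F (0, 0) (1, 0) + F (0, 1) (0, 0)) ∧
    (∑ n, ∑ i, braiding q (0, 0) n (1, 0) i • F n i =
      ((q : k)⁻¹ ^ 2 - 1) • F (0, 0) (0, 1) + F (1, 0) (0, 0)) ∧
    (∑ n, ∑ i, braiding q (0, 0) n (1, 1) i • F n i =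
      (1 + (q : k)⁻¹ ^ 4 - 2 * (q : k)⁻¹ ^ 2) • F (0, 0) (0, 0)
        + (2 * (q : k)⁻¹ ^ 2 - 1 - (q : k)⁻¹ ^ 4) • F (0, 0) (1, 1)
        + ((q : k)⁻¹ ^ 4 - (q : k)⁻¹ ^ 2) • F (0, 1) (0, 1)
        + (1 - (q : k)⁻¹ ^ 2) • F (1, 0) (1, 0) + F (1, 1) (0, 0)) ∧
    (∑ n, ∑ i, braiding q (0, 1) n (0, 0) i • F n i =
      (q : k) ^ 2 • F (0, 0) (0, 1)) ∧
    (∑ n, ∑ i, braiding q (0, 1) n (0, 1) i • F n i =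
      (1 - (q : k) ^ 2) • F (0, 0) (0, 0) + ((q : k) ^ 2 - 1) • F (0, 0) (1, 1)
        + F (0, 1) (0, 1)) ∧
    (∑ n, ∑ i, braiding q (0, 1) n (1, 0) i • F n i =
      F (1, 0) (0, 1)) ∧
    (∑ n, ∑ i, braiding q (0, 1) n (1, 1) i • F n i =
      ((q : k)⁻¹ ^ 2 - 1) • F (1, 0) (0, 0) + (1 - (q : k)⁻¹ ^ 2) • F (1, 0) (1, 1)
        + (q : k)⁻¹ ^ 2 • F (1, 1) (0, 1)) ∧
    (∑ n, ∑ i, braiding q (1, 0) n (0, 0) i • F n i =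
      (q : k)⁻¹ ^ 2 • F (0, 0) (1, 0)) ∧
    (∑ n, ∑ i, braiding q (1, 0) n (0, 1) i • F n i =
      F (0, 1) (1, 0)) ∧
    (∑ n, ∑ i, braiding q (1, 0) n (1, 0) i • F n i =
      (1 - (q : k)⁻¹ ^ 2) • F (0, 0) (0, 0) + ((q : k)⁻¹ ^ 2 - 1) • F (0, 0) (1, 1)
        + F (1, 0) (1, 0)) ∧
    (∑ n, ∑ i, braiding q (1, 0) n (1, 1) i • F n i =
      ((q : k) ^ 2 + (q : k)⁻¹ ^ 4 - 1 - (q : k)⁻¹ ^ 2) • F (0, 0) (1, 0)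
        + (1 - (q : k)⁻¹ ^ 2) • F (0, 1) (0, 0) + ((q : k)⁻¹ ^ 2 - 1) • F (0, 1) (1, 1)
        + (q : k) ^ 2 • F (1, 1) (1, 0)) ∧
    (∑ n, ∑ i, braiding q (1, 1) n (0, 0) i • F n i =
      F (0, 0) (1, 1)) ∧
    (∑ n, ∑ i, braiding q (1, 1) n (0, 1) i • F n i =
      (1 - (q : k) ^ 2) • F (0, 0) (1, 0) + F (0, 1) (1, 1)) ∧
    (∑ n, ∑ i, braiding q (1, 1) n (1, 0) i • F n i =
      ((q : k) ^ 2 - 1) • F (0, 0) (0, 1) + F (1, 0) (1, 1)) ∧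
    (∑ n, ∑ i, braiding q (1, 1) n (1, 1) i • F n i =
      (2 - (q : k)⁻¹ ^ 2 - (q : k) ^ 2) • F (0, 0) (0, 0)
        + ((q : k)⁻¹ ^ 2 + (q : k) ^ 2 - 2) • F (0, 0) (1, 1)
        + (1 - (q : k)⁻¹ ^ 2) • F (0, 1) (0, 1) + (1 - (q : k) ^ 2) • F (1, 0) (1, 0)
        + F (1, 1) (1, 1)) := by
  have h0 : (q : k) ≠ 0 := q.ne_zero
  simp only [Fintype.sum_prod_type, Fin.sum_univ_two, braiding_eq, Matrix.mul_apply, actGen_a,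
    actGen_b, actGen_c, actGen_d, adj_a, adj_b, adj_c, adj_d, Matrix.neg_apply, Matrix.smul_apply]
  refine ⟨?_, ?_, ?_, ?_, ?_, ?_, ?_, ?_, ?_, ?_, ?_, ?_, ?_, ?_, ?_, ?_⟩ <;>
    simp [-mul_eq_zero] <;> (try match_scalars) <;> (try field_simp) <;> (try ring)

/-! ### Identities in the model -/

theorem model_eta {k : Type*} (b : Model k) :
    ![b 0, b 1, b 2, b 3, b 4, b 5, b 6, b 7, b 8, b 9, b 10, b 11, b 12, b 13, b 14, b 15] = b := by
  ext K
  fin_cases K <;> rfl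

set_option maxHeartbeats 2000000 in
/-- The braided Leibniz rule. -/
theorem bder_leftMul (q : kˣ) (m j : Idx) (b : Model k) :
    bder q m (leftMul q j b) =
      (if m = j then b else 0) - ∑ n, ∑ i, braiding q m n j i • leftMul q n (bder q i b) := by
  have h0 : (q : k) ≠ 0 := q.ne_zero
  -- Spelling out `b` as a literal vector makes both sides literal vectors, so the rule splits into
  -- sixteen scalar identities for each pair of letters.
  have hb : (if m = j then b else 0) = if m = j then ![b 0, b 1, b 2, b 3, b 4, b 5, b 6, b 7,
      b 8, b 9, b 10, b 11, b 12, b 13, b 14, b 15] else 0 := by rw [model_eta]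
  rw [hb]
  clear hb
  have hsum := sum_braiding q fun n i => leftMul q n (bder q i b)
  obtain ⟨m, m'⟩ := m
  obtain ⟨j, j'⟩ := j
  fin_cases m <;> fin_cases m' <;> fin_cases j <;> fin_cases j' <;>
    simp only [Fin.mk_one, Fin.zero_eta, hsum, bder_a, bder_b, bder_c, bder_d, leftMul_a, leftMul_b,
      leftMul_c, leftMul_d] <;>
    simp <;> (try repeat' apply And.intro) <;> (try field_simp) <;> (try ring)

/-- This is the associativity $e_i(be_j)=(e_ib)e_j$. It lets facts about left multiplication be
checked on the vector $1$ alone. -/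
theorem leftMul_rightMul_comm (q : kˣ) (i j : Idx) (b : Model k) :
    leftMul q i (rightMul q j b) = rightMul q j (leftMul q i b) := by
  have h0 : (q : k) ≠ 0 := q.ne_zero
  obtain ⟨i, i'⟩ := i
  obtain ⟨j, j'⟩ := j
  fin_cases i <;> fin_cases i' <;> fin_cases j <;> fin_cases j' <;>
    simp only [Fin.mk_one, Fin.zero_eta, leftMul_a, leftMul_b, leftMul_c, leftMul_d, rightMul_a,
      rightMul_b, rightMul_c, rightMul_d] <;>
    simp [h0] <;> (try repeat' apply And.intro) <;> (try field_simp) <;> (try ring)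

theorem bder_one (q : kˣ) (i : Idx) : bder q i (Pi.single 0 1) = 0 := by
  obtain ⟨i, i'⟩ := i
  fin_cases i <;> fin_cases i' <;>
    simp [bder_a, bder_b, bder_c, bder_d]

/-- In positive degree the braided derivations have no common kernel. -/
theorem eq_zero_of_bder_eq_zero (q : kˣ) (b : Model k) (h0 : b 0 = 0)
    (h : ∀ i, bder q i b = 0) : b = 0 := by
  have hq : (q : k) ≠ 0 := q.ne_zero
  have ha := h (0, 0)
  have hb := h (0, 1)
  have hc := h (1, 0)
  have hd := h (1, 1)
  simp only [bder_a, bder_b, bder_c, bder_d] at ha hb hc hd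
  simp [hq] at ha hb hc hd
  -- Each positive-degree coordinate `b K` occurs alone with coefficient $1$ in some $\partial_ib$,
  -- namely for $e_i$ the first letter of the `K`-th monomial.
  ext K
  fin_cases K <;> simp_all

theorem rightMul_one (q : kˣ) (i : Idx) :
    rightMul q i (Pi.single 0 1) = leftMul q i (Pi.single 0 1) := by
  obtain ⟨i, i'⟩ := i
  fin_cases i <;> fin_cases i' <;>
    simp [leftMul_a, leftMul_b, leftMul_c, leftMul_d, rightMul_a, rightMul_b, rightMul_c, rightMul_d]

theorem leftMul_supported (q : kˣ) (i : Idx) (m : ℕ) (b : Model k)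
    (hb : ∀ K, m ≠ monDeg K → b K = 0) (K : Fin 16) (hK : m + 1 ≠ monDeg K) :
    leftMul q i b K = 0 := by
  simp [Fin.forall_fin_succ, monDeg] at hb
  obtain ⟨i, i'⟩ := i
  fin_cases i <;> fin_cases i' <;>
    simp only [Fin.mk_one, Fin.zero_eta, leftMul_a, leftMul_b, leftMul_c, leftMul_d] <;>
    fin_cases K <;> simp [monDeg] at hK ⊢ <;> (try simp_all)

theorem bderDual_supported (q : kˣ) (i : Idx) (m : ℕ) (b : Model k)
    (hb : ∀ K, m ≠ monDeg K → b K = 0) (K : Fin 16) (hK : m + 1 ≠ monDeg K) :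
    bderDual q i b K = 0 := by
  simp [Fin.forall_fin_succ, monDeg] at hb
  obtain ⟨i, i'⟩ := i
  fin_cases i <;> fin_cases i' <;>
    simp only [Fin.mk_one, Fin.zero_eta, bderDual_a, bderDual_b, bderDual_c, bderDual_d] <;>
    fin_cases K <;> simp [monDeg] at hK ⊢ <;> (try simp_all)

theorem sum_bder_mul (q : kˣ) (i : Idx) (b y : Model k) :
    ∑ K, bder q i b K * y K = ∑ K, b K * bderDual q i y K := by
  obtain ⟨i, i'⟩ := i
  fin_cases i <;> fin_cases i' <;>
    simp [bder_a, bder_b, bder_c, bder_d, bderDual_a, bderDual_b, bderDual_c, bderDual_d,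
      Fin.sum_univ_succ] <;> ring

theorem expMat_one (q : kˣ) : expMat q (Pi.single 0 1) = Pi.single 0 1 := by
  rw [expMat_apply]
  ext K
  fin_cases K <;> simp

/-- The coefficients of $e_z\otimes e_z-\theta\otimes\theta$ are $q^{-4}-1$, $-(q^{-2}+1)$ and $0$,
all divisible by $q+q^{-1}$. Cancelling that factor is where $q^2\ne-1$ enters. -/
theorem metric_eq (q : kˣ) (hq' : (q : k) ^ 2 ≠ -1) (i j : Idx) : metric q i j =
    if i = (1, 0) ∧ j = (0, 1) then 1
    else if i = (0, 1) ∧ j = (1, 0) then (q : k) ^ 2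
    else if i = (0, 0) ∧ j = (0, 0) then 1 - (q : k) ^ 2
    else if i = (0, 0) ∧ j = (1, 1) ∨ i = (1, 1) ∧ j = (0, 0) then -(q : k) ^ 2 else 0 := by
  have h0 : (q : k) ≠ 0 := q.ne_zero
  have h1 : (q : k) ^ 2 + 1 ≠ 0 := fun h => hq' (eq_neg_of_add_eq_zero_left h)
  have h2 : (q : k) + (q : k)⁻¹ = ((q : k) ^ 2 + 1) / q := by field_simp
  obtain ⟨i, i'⟩ := i
  obtain ⟨j, j'⟩ := j
  rw [metric, h2]
  fin_cases i <;> fin_cases i' <;> fin_cases j <;> fin_cases j' <;>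
    simp [zVec, thetaVec] <;> (try field_simp) <;> (try ring)

/-- The braided derivations of the first factor of `exp` are right multiplications of the second
factor by the dual basis. -/
theorem expMat_bderDual (q : kˣ) (hq' : (q : k) ^ 2 ≠ -1) (i : Idx) (y : Model k) :
    expMat q (bderDual q i y) = ∑ j, metric q i j • rightMul q j (expMat q y) := by
  have h0 : (q : k) ≠ 0 := q.ne_zero
  obtain ⟨i, i'⟩ := i
  simp only [Fintype.sum_prod_type, Fin.sum_univ_two, metric_eq q hq']
  fin_cases i <;> fin_cases i' <;>
    simp [bderDual_a, bderDual_b, bderDual_c, bderDual_d, rightMul_a, rightMul_b,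
      rightMul_c, rightMul_d, expMat_apply] <;> 
      (try repeat' apply And.intro) <;> (try field_simp) <;> (try ring)

/-- The matrix exchanges degrees $m$ and $4-m$; its square is $q^6$ on all coordinates outside
degree $2$, so only the vanishing of the degree-2 coordinates matters. -/
theorem hodge_hodge (q : kˣ) (m : ℕ) (hm : m ≠ 2) (b : Model k)
    (hb : ∀ K, m ≠ monDeg K → b K = 0) : hodge q (hodge q b) = (q : k) ^ 6 • b := by
  have h2 : ∀ K, monDeg K = 2 → b K = 0 := fun K hK => hb K (by omega)
  simp [Fin.forall_fin_succ, monDeg] at h2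
  simp only [hodge_apply]
  ext K
  fin_cases K <;> simp [h2] <;> ring

/-- This is $(T-q^4)(T+q^2)=0$ on the degree-2 block, solved for $T^2$. -/
theorem hodge_hecke (q : kˣ) (b : Model k) (hb : ∀ K, 2 ≠ monDeg K → b K = 0) :
    hodge q (hodge q b) = (q : k) ^ 6 • b + ((q : k) ^ 4 - (q : k) ^ 2) • hodge q b := by
  simp [Fin.forall_fin_succ, monDeg] at hb
  simp only [hodge_apply]
  ext K
  fin_cases K <;> simp [hb] <;> ring

/-! ### Braided factorials and the model -/

/-- The action of the tensor algebra on the model by left multiplication. -/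
def leftRep (q : kˣ) : FreeAlgebra k Idx →ₐ[k] Module.End k (Model k) :=
  FreeAlgebra.lift k (leftMul q)

theorem leftRep_ι (q : kˣ) (i : Idx) : leftRep q (FreeAlgebra.ι k i) = leftMul q i :=
  FreeAlgebra.lift_ι_apply _ _

/-- The projection from `V^{⊗ m}` to the model. -/
def toModel (q : kˣ) (m : ℕ) : Tens k m →ₗ[k] Model k :=
  LinearMap.applyₗ (Pi.single 0 1) ∘ₗ (leftRep q).toLinearMap ∘ₗ toFree k m

theorem toModel_apply (q : kˣ) (m : ℕ) (f : Tens k m) :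
    toModel q m f = leftRep q (toFree k m f) (Pi.single 0 1) := rfl

theorem toFree_zero (f : Tens k 0) : toFree k 0 f = algebraMap k _ (f Fin.elim0) := by
  simp only [toFree, Fintype.linearCombination_apply, Finset.univ_unique, Finset.sum_singleton,
    List.ofFn_zero, List.prod_nil, Algebra.algebraMap_eq_smul_one]
  exact congrArg (fun w => f w • (1 : FreeAlgebra k Idx)) (Subsingleton.elim _ _)

theorem toFree_succ (m : ℕ) (f : Tens k (m + 1)) :
    toFree k (m + 1) f =
      ∑ i, FreeAlgebra.ι k i * toFree k m fun v => f (Fin.cons i v) := by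
  simp only [toFree, Fintype.linearCombination_apply]
  rw [← (Fin.consEquiv fun _ : Fin (m + 1) => Idx).sum_comp, Fintype.sum_prod_type]
  refine Finset.sum_congr rfl fun i _ => ?_
  rw [Finset.mul_sum]
  refine Finset.sum_congr rfl fun v _ => ?_
  simp [List.ofFn_succ]
  rfl

theorem toModel_zero (q : kˣ) (f : Tens k 0) :
    toModel q 0 f = f Fin.elim0 • Pi.single 0 1 := by
  rw [toModel_apply, toFree_zero, AlgHom.commutes, Module.algebraMap_end_apply]

theorem toModel_succ (q : kˣ) (m : ℕ) (f : Tens k (m + 1)) :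
    toModel q (m + 1) f = ∑ i, leftMul q i (toModel q m fun v => f (Fin.cons i v)) := by
  simp only [toModel_apply, toFree_succ, map_sum, map_mul, leftRep_ι, LinearMap.sum_apply,
    Module.End.mul_apply]

/-- The braided integers are given by the braided derivations. -/
theorem bder_toModel (q : kˣ) (m : ℕ) (f : Tens k (m + 1)) (i : Idx) :
    bder q i (toModel q (m + 1) f) =
      toModel q m fun v => braidedInt (-braiding q) (m + 1) f (Fin.cons i v) := by
  induction m generalizing i with
  | zero =>
    rw [toModel_succ, map_sum, toModel_zero, Finset.sum_eq_single i]
    · rw [toModel_zero, bder_leftMul]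
      simp [bder_one, braidedInt]
    · intro j _ hj
      rw [toModel_zero, bder_leftMul]
      simp [bder_one, hj.symm]
    · simp
  | succ m ih =>
    -- This unfolds $[m+2,-\Psi]=\mathrm{id}-\Psi_1(\mathrm{id}\otimes[m+1,-\Psi])$ at first letter
    -- `i`; the two terms match the two terms of the braided Leibniz rule.
    have hR : (fun v : Fin (m + 1) → Idx => braidedInt (-braiding q) (m + 2) f (Fin.cons i v)) =
        (fun v => f (Fin.cons i v)) - ∑ j : Idx, ∑ l : Idx, fun v : Fin (m + 1) → Idx =>
          braiding q i (v 0) j l * braidedInt (-braiding q) (m + 1) (fun u => f (Fin.cons j u))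
              (Fin.cons l (Fin.tail v)) := by
      funext v
      simp [braidedInt, firstTwo, idTensor, Finset.sum_apply, sub_eq_add_neg]
    rw [hR, map_sub, toModel_succ, map_sum]
    simp only [bder_leftMul, Finset.sum_sub_distrib, Finset.sum_ite_eq, Finset.mem_univ, if_true,
      map_sum]
    congr 1
    refine Finset.sum_congr rfl fun j _ => ?_
    rw [Finset.sum_comm]
    refine Finset.sum_congr rfl fun l _ => ?_
    refine Eq.trans (Finset.sum_congr rfl fun n _ => ?_) (toModel_succ q m _).symm
    rw [ih, ← (leftMul q n).map_smul, ← (toModel q m).map_smul]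
    simp only [Fin.cons_zero, Fin.tail_cons]
    rfl

/-- The functional `∂_{w (m-1)} ⋯ ∂_{w 0}` followed by the projection to degree zero. -/
def dualWord (q : kˣ) : (m : ℕ) → (Fin m → Idx) → Model k
  | 0, _ => Pi.single 0 1
  | m + 1, w => bderDual q (w 0) (dualWord q m (Fin.tail w))

theorem dualWord_supported (q : kˣ) (m : ℕ) (w : Fin m → Idx) (K : Fin 16) (hK : m ≠ monDeg K) :
    dualWord q m w K = 0 := by
  induction m generalizing K with
  | zero =>
    have : K ≠ 0 := by
      rintro rfl
      exact hK rfl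
    simp [dualWord, this]
  | succ m ih => exact bderDual_supported q _ m _ (ih _) K hK

theorem toModel_supported (q : kˣ) (m : ℕ) (f : Tens k m) (K : Fin 16) (hK : m ≠ monDeg K) :
    toModel q m f K = 0 := by
  induction m generalizing K with
  | zero =>
    have : K ≠ 0 := by
      rintro rfl
      exact hK rfl
    simp [toModel_zero, this]
  | succ m ih =>
    rw [toModel_succ, Finset.sum_apply]
    exact Finset.sum_eq_zero fun i _ => leftMul_supported q i m _ (ih _) K hK

/-- Each factor of the factorial contributes one derivation $\partial_{w_0},\partial_{w_1},\dots$;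
moving these to the other side of the pairing builds up `dualWord`. Thus $[m,-\Psi]!$ factors
through the model. -/
theorem braidedFact_eq_sum (q : kˣ) (m : ℕ) (f : Tens k m) (w : Fin m → Idx) :
    braidedFact (-braiding q) m f w = ∑ K, toModel q m f K * dualWord q m w K := by
  induction m with
  | zero =>
    rw [toModel_zero, Subsingleton.elim w Fin.elim0]
    simp [braidedFact, dualWord, Pi.single_apply]
  | succ m ih =>
    have h : braidedFact (-braiding q) (m + 1) f w = braidedFact (-braiding q) m
      (fun v => braidedInt (-braiding q) (m + 1) f (Fin.cons (w 0) v)) (Fin.tail w) := rfl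
    rw [h, ih, ← bder_toModel, sum_bder_mul]
    rfl

/-- If $[m+1,-\Psi]!f=0$, then $[m,-\Psi]!$ kills every first-letter slice of $[m+1,-\Psi]f$. By
induction those slices vanish in the model, that is, every $\partial_i$ kills the image of $f$, and
the image is zero. The converse is the factorisation through the model. -/
theorem toModel_eq_zero_iff (q : kˣ) (m : ℕ) (f : Tens k m) :
    toModel q m f = 0 ↔ braidedFact (-braiding q) m f = 0 := by
  refine ⟨fun h => funext fun w => by simp [braidedFact_eq_sum, h], fun h => ?_⟩
  induction m with
  | zero =>
    have : f = 0 := h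
    rw [this, map_zero]
  | succ m ih =>
    refine eq_zero_of_bder_eq_zero q _ (toModel_supported q _ f 0 (Nat.succ_ne_zero m)) fun i => ?_
    rw [bder_toModel]
    refine ih _ (funext fun w => ?_)
    have := congrFun h (Fin.cons i w)
    simpa [braidedFact, idTensor] using this

/-! ### The isomorphism of `Λ` with the model -/

theorem leftRep_rightMul (q : kˣ) (y : FreeAlgebra k Idx) (j : Idx) (b : Model k) :
    leftRep q y (rightMul q j b) = rightMul q j (leftRep q y b) := by
  induction y using FreeAlgebra.induction generalizing b with
  | grade0 c => simp [Module.algebraMap_end_apply]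
  | grade1 i => rw [leftRep_ι, leftMul_rightMul_comm]
  | mul y z hy hz => simp [hy, hz]
  | add y z hy hz => simp [hy, hz]

/-- The last letter of an ordered monomial. -/
def lastLetter : Fin 16 → Idx :=
  ![(0, 0), (0, 0), (0, 1), (1, 0), (1, 1), (0, 1), (1, 0), (1, 1), (1, 0), (1, 1), (1, 1), (1, 0),
    (1, 1), (1, 1), (1, 1), (1, 1)]

/-- An ordered monomial without its last letter. -/
def dropLast : Fin 16 → Fin 16 := ![0, 0, 0, 0, 0, 1, 1, 1, 2, 2, 3, 5, 5, 6, 8, 11]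

/-- The monomials are listed so that deleting the last letter lowers the index, which supports
inductions that build each monomial from $1$ by right multiplications. The entries of `dropLast` and
`lastLetter` at `0` are placeholders. -/
theorem dropLast_lt (K : Fin 16) (hK : K ≠ 0) : dropLast K < K := by
  revert K
  decide

theorem monDeg_dropLast (K : Fin 16) (hK : K ≠ 0) : monDeg (dropLast K) + 1 = monDeg K := by
  revert K
  decide

theorem rightMul_lastLetter (q : kˣ) (K : Fin 16) (hK : K ≠ 0) :
    rightMul q (lastLetter K) (Pi.single (dropLast K) 1) = Pi.single K (1 : k) := by
  fin_cases K <;> simp [lastLetter, dropLast, rightMul_a, rightMul_b, rightMul_c,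
    rightMul_d] at hK ⊢ <;>
    ext L <;> fin_cases L <;> simp

/-- Left multiplications commute with right multiplications, and these generate every basis vector
from $1$; an element that kills $1$ therefore kills everything. This is what makes the action
descend to $\Lambda$. -/
theorem leftRep_eq_zero (q : kˣ) (y : FreeAlgebra k Idx)
    (h : leftRep q y (Pi.single 0 1) = 0) : leftRep q y = 0 := by
  refine (Pi.basisFun k (Fin 16)).ext fun K => ?_
  rw [Pi.basisFun_apply, LinearMap.zero_apply]
  induction K using WellFoundedLT.induction with
  | ind K ih =>
    by_cases hK : K = 0
    · rw [hK, h]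
    · rw [← rightMul_lastLetter q K hK, leftRep_rightMul, ih _ (dropLast_lt K hK), map_zero]

/-- The action of `Λ` on the model by left multiplication. -/
def extRep (q : kˣ) : ExtAlg q →ₐ[k] Module.End k (Model k) :=
  RingQuot.liftAlgHom k (s := ExtRel q) ⟨leftRep q, by
    rintro _ _ ⟨m, f, hf⟩
    rw [map_zero]
    exact leftRep_eq_zero q _ ((toModel_eq_zero_iff q m f).2 hf)⟩

theorem extRep_mkExt (q : kˣ) (y : FreeAlgebra k Idx) : extRep q (mkExt q y) = leftRep q y :=
  RingQuot.liftAlgHom_mkAlgHom_apply k (s := ExtRel q) _ _ _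

theorem extRep_e (q : kˣ) (i : Idx) : extRep q (e q i) = leftMul q i := by
  rw [e, extRep_mkExt, leftRep_ι]

/-- The coordinates of an element of `Λ` in the basis of ordered monomials. -/
def coords (q : kˣ) : ExtAlg q →ₗ[k] Model k :=
  LinearMap.applyₗ (Pi.single 0 1) ∘ₗ (extRep q).toLinearMap

theorem coords_apply (q : kˣ) (ω : ExtAlg q) : coords q ω = extRep q ω (Pi.single 0 1) := rfl

theorem coords_one (q : kˣ) : coords q 1 = Pi.single 0 1 := by
  rw [coords_apply, map_one, Module.End.one_apply]

theorem coords_mul (q : kˣ) (ω η : ExtAlg q) : coords q (ω * η) = extRep q ω (coords q η) := by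
  rw [coords_apply, coords_apply, map_mul, Module.End.mul_apply]

theorem mkExt_surjective (q : kˣ) : Function.Surjective (mkExt q) :=
  RingQuot.mkAlgHom_surjective k (ExtRel q)

theorem coords_mul_e (q : kˣ) (ω : ExtAlg q) (i : Idx) :
    coords q (ω * e q i) = rightMul q i (coords q ω) := by
  obtain ⟨y, rfl⟩ := mkExt_surjective q ω
  rw [coords_mul, coords_apply, coords_apply, extRep_e, extRep_mkExt, ← rightMul_one,
    leftRep_rightMul]

theorem coords_proj (q : kˣ) (m : ℕ) (f : Tens k m) : coords q (proj q m f) = toModel q m f := by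
  rw [coords_apply, proj, LinearMap.comp_apply, AlgHom.toLinearMap_apply, extRep_mkExt,
    toModel_apply]

theorem proj_eq_zero (q : kˣ) (m : ℕ) (f : Tens k m) (h : braidedFact (-braiding q) m f = 0) :
    proj q m f = 0 :=
  (RingQuot.mkAlgHom_rel k (ExtRel.ker m f h)).trans (map_zero _)

theorem coords_supported (q : kˣ) {m : ℕ} {ω : ExtAlg q} (hω : ω ∈ extDeg q m) (K : Fin 16)
    (hK : m ≠ monDeg K) : coords q ω K = 0 := by
  obtain ⟨f, rfl⟩ := hω
  rw [coords_proj, toModel_supported q m f K hK]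

theorem coords_injOn (q : kˣ) {m : ℕ} {ω η : ExtAlg q} (hω : ω ∈ extDeg q m)
    (hη : η ∈ extDeg q m) (h : coords q ω = coords q η) : ω = η := by
  obtain ⟨f, rfl⟩ := hω
  obtain ⟨g, rfl⟩ := hη
  rw [coords_proj, coords_proj, ← sub_eq_zero, ← map_sub, toModel_eq_zero_iff] at h
  rw [← sub_eq_zero, ← map_sub, proj_eq_zero q m _ h]

theorem proj_zero (q : kˣ) (f : Tens k 0) : proj q 0 f = f Fin.elim0 • 1 := by
  rw [proj, LinearMap.comp_apply, toFree_zero, AlgHom.toLinearMap_apply, AlgHom.commutes,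
    Algebra.algebraMap_eq_smul_one]

theorem toFree_snoc (m : ℕ) (f : Tens k (m + 1)) :
    toFree k (m + 1) f =
      ∑ i, (toFree k m fun v => f (Fin.snoc v i)) * FreeAlgebra.ι k i := by
  simp only [toFree, Fintype.linearCombination_apply]
  rw [← (Fin.snocEquiv fun _ : Fin (m + 1) => Idx).sum_comp, Fintype.sum_prod_type]
  refine Finset.sum_congr rfl fun i _ => ?_
  rw [Finset.sum_mul]
  refine Finset.sum_congr rfl fun v _ => ?_
  have h : (Fin.snocEquiv fun _ : Fin (m + 1) => Idx) (i, v) = Fin.snoc v i := rfl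
  rw [h, List.ofFn_succ']
  simp

theorem proj_snoc (q : kˣ) (m : ℕ) (f : Tens k (m + 1)) :
    proj q (m + 1) f = ∑ i, (proj q m fun v => f (Fin.snoc v i)) * e q i := by
  simp only [proj, LinearMap.comp_apply, toFree_snoc, AlgHom.toLinearMap_apply, map_sum, map_mul, e]

theorem one_mem_extDeg (q : kˣ) : (1 : ExtAlg q) ∈ extDeg q 0 :=
  ⟨fun _ => 1, by rw [proj_zero, one_smul]⟩

theorem mul_e_mem_extDeg (q : kˣ) (i : Idx) {m : ℕ} {ω : ExtAlg q} (hω : ω ∈ extDeg q m) :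
    ω * e q i ∈ extDeg q (m + 1) := by
  obtain ⟨f, rfl⟩ := hω
  refine ⟨fun w => if w (Fin.last m) = i then f (Fin.init w) else 0, ?_⟩
  rw [proj_snoc, Finset.sum_eq_single i]
  · simp
  · intro j _ hj
    simp only [Fin.snoc_last, if_neg hj]
    exact (congrArg (· * e q j) (map_zero (proj q m))).trans (zero_mul _)
  · simp

/-! ### The ordered monomials as a basis of $\Lambda$. -/

/-- The ordered monomials. -/
def mon (q : kˣ) : Fin 16 → ExtAlg q :=
  ![1, ea q, eb q, ec q, ed q, ea q * eb q, ea q * ec q, ea q * ed q, eb q * ec q, eb q * ed q,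
    ec q * ed q, ea q * eb q * ec q, ea q * eb q * ed q, ea q * ec q * ed q, eb q * ec q * ed q,
    ea q * eb q * ec q * ed q]

theorem mon_zero (q : kˣ) : mon q 0 = 1 := rfl

theorem mon_eq_mul (q : kˣ) (K : Fin 16) (hK : K ≠ 0) :
    mon q K = mon q (dropLast K) * e q (lastLetter K) := by
  fin_cases K <;> simp [mon, dropLast, lastLetter, ea, eb, ec, ed] at hK ⊢

theorem coords_mon (q : kˣ) (K : Fin 16) : coords q (mon q K) = Pi.single K 1 := by
  induction K using WellFoundedLT.induction with
  | ind K ih =>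
    by_cases hK : K = 0
    · rw [hK, mon_zero, coords_one]
    · rw [mon_eq_mul q K hK, coords_mul_e, ih _ (dropLast_lt K hK), rightMul_lastLetter q K hK]

theorem mon_mem_extDeg (q : kˣ) (K : Fin 16) : mon q K ∈ extDeg q (monDeg K) := by
  induction K using WellFoundedLT.induction with
  | ind K ih =>
    by_cases hK : K = 0
    · rw [hK]
      exact one_mem_extDeg q
    · rw [mon_eq_mul q K hK, ← monDeg_dropLast K hK]
      exact mul_e_mem_extDeg q _ (ih _ (dropLast_lt K hK))

/-- The element of `Λ` with given coordinates in the ordered monomials. -/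
def ofCoords (q : kˣ) : Model k →ₗ[k] ExtAlg q := Fintype.linearCombination k (mon q)

theorem ofCoords_apply (q : kˣ) (b : Model k) : ofCoords q b = ∑ K, b K • mon q K :=
  Fintype.linearCombination_apply k _ b

theorem ofCoords_single (q : kˣ) (K : Fin 16) : ofCoords q (Pi.single K 1) = mon q K := by
  rw [ofCoords, Fintype.linearCombination_apply_single, one_smul]

theorem coords_ofCoords (q : kˣ) (b : Model k) : coords q (ofCoords q b) = b := by
  rw [ofCoords_apply, map_sum]
  simp only [map_smul, coords_mon]
  exact (pi_eq_sum_univ' b).symm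

theorem ofCoords_coords_of_mem (q : kˣ) {m : ℕ} {ω : ExtAlg q} (hω : ω ∈ extDeg q m) :
    ofCoords q (coords q ω) = ω := by
  refine coords_injOn q ?_ hω (coords_ofCoords q _)
  rw [ofCoords_apply]
  refine Submodule.sum_mem _ fun K _ => ?_
  by_cases hK : m = monDeg K
  · rw [hK]
    exact Submodule.smul_mem _ _ (mon_mem_extDeg q K)
  · rw [coords_supported q hω K hK, zero_smul]
    exact Submodule.zero_mem _

theorem ofCoords_coords (q : kˣ) (ω : ExtAlg q) : ofCoords q (coords q ω) = ω := by
  -- Injectivity of `coords` is known only within one degree, and a general element is not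
  -- homogeneous. The set of good `ω` contains $1$ and is stable under right multiplication by
  -- generators, since each monomial times a letter is homogeneous.
  suffices h : ∀ (y : FreeAlgebra k Idx) (ω : ExtAlg q), ofCoords q (coords q ω) = ω →
      ofCoords q (coords q (ω * mkExt q y)) = ω * mkExt q y by
    obtain ⟨y, rfl⟩ := mkExt_surjective q ω
    have := h y 1 (ofCoords_coords_of_mem q (one_mem_extDeg q))
    rwa [one_mul] at this
  intro y
  induction y using FreeAlgebra.induction with
  | grade0 c =>
    intro ω hω
    rw [AlgHom.commutes, ← Algebra.commutes, ← Algebra.smul_def, map_smul, map_smul, hω]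
  | grade1 i =>
    intro ω hω
    rw [← hω, ofCoords_apply q (coords q ω), Finset.sum_mul, map_sum, map_sum]
    refine Finset.sum_congr rfl fun K _ => ?_
    rw [smul_mul_assoc, map_smul, map_smul]
    exact congrArg _ (ofCoords_coords_of_mem q (mul_e_mem_extDeg q i (mon_mem_extDeg q K)))
  | mul y z hy hz =>
    intro ω hω
    rw [map_mul (mkExt q), ← mul_assoc]
    exact hz _ (hy _ hω)
  | add y z hy hz =>
    intro ω hω
    rw [map_add (mkExt q), mul_add, map_add, map_add, hy _ hω, hz _ hω]

theorem coords_injective (q : kˣ) : Function.Injective (coords q) :=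
  Function.LeftInverse.injective (ofCoords_coords q)

theorem finrank_extDeg (q : kˣ) (m : ℕ) : Module.finrank k (extDeg q m) = Nat.choose 4 m := by
  have hli : LinearIndependent k (mon q) := by
    refine LinearIndependent.of_comp (coords q) ?_
    have : coords q ∘ mon q = Pi.basisFun k (Fin 16) := by
      funext K
      rw [Function.comp_apply, coords_mon, Pi.basisFun_apply]
    rw [this]
    exact (Pi.basisFun k (Fin 16)).linearIndependent
  have hspan : extDeg q m = Submodule.span k
      (Set.range fun K : {K // m = monDeg K} => mon q K) := by
    refine le_antisymm (fun ω hω => ?_) (Submodule.span_le.2 ?_)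
    · rw [← ofCoords_coords q ω, ofCoords_apply]
      refine Submodule.sum_mem _ fun K _ => ?_
      by_cases hK : m = monDeg K
      · exact Submodule.smul_mem _ _ (Submodule.subset_span ⟨⟨K, hK⟩, rfl⟩)
      · rw [coords_supported q hω K hK, zero_smul]
        exact Submodule.zero_mem _
    · rintro _ ⟨⟨K, rfl⟩, rfl⟩
      exact mon_mem_extDeg q K
  rw [hspan]
  refine (finrank_span_eq_card (hli.comp _ Subtype.val_injective)).trans ?_
  rw [Fintype.card_subtype]
  rcases lt_or_ge m 5 with hm | hm
  · interval_cases m <;> decide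
  · rw [Nat.choose_eq_zero_of_lt (by omega), Finset.card_eq_zero, Finset.filter_eq_empty_iff]
    intro K _ hK
    have : ∀ K, monDeg K < 5 := by decide
    have := this K
    omega

/-! ### The integral -/

theorem vol_eq (q : kˣ) : vol q = mon q 15 := rfl

/-- The monomials span $\Lambda$ and only the last one, $\mathrm{Vol}$, has degree $4$, so the two
conditions fix the functional on a basis. -/
theorem isExtIntegral_iff (q : kˣ) (I : ExtAlg q →ₗ[k] k) :
    IsExtIntegral q I ↔ I = ξ 15 ∘ₗ coords q := by
  refine ⟨fun ⟨h1, h2⟩ => ?_, ?_⟩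
  · have hI : I ∘ₗ ofCoords q = ξ 15 := by
      refine (Pi.basisFun k (Fin 16)).ext fun K => ?_
      rw [Pi.basisFun_apply, LinearMap.comp_apply, ofCoords_single, LinearMap.proj_apply]
      by_cases hK : K = 15
      · rw [hK, ← vol_eq, h1, Pi.single_eq_same]
      · rw [Pi.single_eq_of_ne (Ne.symm hK)]
        refine h2 (monDeg K) ?_ _ (mon_mem_extDeg q K)
        revert K
        decide
    refine LinearMap.ext fun ω => ?_
    rw [← hI, LinearMap.comp_apply, LinearMap.comp_apply, ofCoords_coords]
  · rintro rfl
    refine ⟨?_, fun m hm ω hω => coords_supported q hω 15 hm⟩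
    rw [LinearMap.comp_apply, vol_eq, coords_mon, LinearMap.proj_apply, Pi.single_eq_same]

theorem existsUnique_isExtIntegral (q : kˣ) : ∃! I : ExtAlg q →ₗ[k] k, IsExtIntegral q I :=
  ⟨ξ 15 ∘ₗ coords q, (isExtIntegral_iff q _).2 rfl, fun I hI => (isExtIntegral_iff q I).1 hI⟩

theorem integral_eq (q : kˣ) : integral q = ξ 15 ∘ₗ coords q :=
  (isExtIntegral_iff q _).1 (Classical.epsilon_spec (existsUnique_isExtIntegral q).exists)

/-! ### The element `exp` -/

/-- The projection kills $\ker[m,-\Psi]!$, so it factors through the range of $[m,-\Psi]!$; a linear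
section of the factorial, extended arbitrarily to the whole tensor power, gives `G`. -/
theorem exists_comp_braidedFact (q : kˣ) (m : ℕ) :
    ∃ G : Tens k m →ₗ[k] ExtAlg q, G ∘ₗ braidedFact (-braiding q) m = proj q m := by
  obtain ⟨s, hs⟩ := (braidedFact (-braiding q) m).rangeRestrict.exists_rightInverse_of_surjective
    (LinearMap.range_rangeRestrict _)
  obtain ⟨g, hg⟩ := s.exists_extend
  refine ⟨proj q m ∘ₗ g, LinearMap.ext fun f => ?_⟩
  have h1 : g (braidedFact (-braiding q) m f) =
      s ((braidedFact (-braiding q) m).rangeRestrict f) := by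
    rw [← hg]
    rfl
  have h2 := congrArg Subtype.val
    (LinearMap.congr_fun hs ((braidedFact (-braiding q) m).rangeRestrict f))
  rw [LinearMap.comp_apply, LinearMap.comp_apply, h1, ← sub_eq_zero, ← map_sub]
  refine proj_eq_zero q m _ ?_
  rw [map_sub, sub_eq_zero]
  exact h2

/-- Applying `G` to the first factor recovers `E` from the coevaluation alone, whatever inverse
image was chosen. -/
theorem IsExpDeg.unique (q : kˣ) {m : ℕ} {E E' : ExtAlg q ⊗[k] ExtAlg q} (h : IsExpDeg q m E)
    (h' : IsExpDeg q m E') : E = E' := by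
  obtain ⟨G, hG⟩ := exists_comp_braidedFact q m
  have key : ∀ {E}, IsExpDeg q m E → E = TensorProduct.map G LinearMap.id
      (TensorProduct.map LinearMap.id (proj q m) (coevMetric q m)) := by
    rintro _ ⟨X, hX, rfl⟩
    rw [← hX, ← LinearMap.comp_apply, ← TensorProduct.map_comp, hG, LinearMap.id_comp]
  rw [key h, key h']

/-- The degree `m` part of `exp` in terms of the ordered monomials. -/
def expPart (q : kˣ) (m : ℕ) : ExtAlg q ⊗[k] ExtAlg q :=
  ∑ K with monDeg K = m, mon q K ⊗ₜ[k] ofCoords q (expMat q (Pi.single K 1))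

/-- Because the coevaluation is nested, the first letter of `w` is paired with the last letter of
`v`. Peeling off both is a right multiplication, which `expMat_bderDual` matches with the outermost
`bderDual` of `dualWord`. -/
theorem toModel_metric (q : kˣ) (hq' : (q : k) ^ 2 ≠ -1) (m : ℕ) (w : Fin m → Idx) :
    toModel q m (fun v => ∏ i, metric q (w i) (v i.rev)) = expMat q (dualWord q m w) := by
  induction m with
  | zero => simp [toModel_zero, dualWord, expMat_one]
  | succ m ih =>
    have h : ∀ j, (fun v : Fin m → Idx => ∏ i : Fin (m + 1),
        metric q (w i) ((Fin.snoc v j : Fin (m + 1) → Idx) i.rev)) =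
        metric q (w 0) j • fun v => ∏ i, metric q (Fin.tail w i) (v i.rev) := by
      intro j
      funext v
      simp [Fin.prod_univ_succ, Fin.rev_succ, Fin.tail]
    rw [← coords_proj, proj_snoc, map_sum, dualWord, expMat_bderDual q hq', ← ih]
    refine Finset.sum_congr rfl fun j _ => ?_
    rw [coords_mul_e, coords_proj, h, map_smul, map_smul]

theorem proj_metric (q : kˣ) (hq' : (q : k) ^ 2 ≠ -1) (m : ℕ) (w : Fin m → Idx) :
    proj q m (fun v => ∏ i, metric q (w i) (v i.rev)) = ofCoords q (expMat q (dualWord q m w)) := by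
  rw [← toModel_metric q hq', ← coords_proj, ofCoords_coords]

theorem map_proj_coevMetric (q : kˣ) (hq' : (q : k) ^ 2 ≠ -1) (m : ℕ) :
    TensorProduct.map LinearMap.id (proj q m) (coevMetric q m) =
      ∑ w : Fin m → Idx, (Pi.single w 1 : Tens k m) ⊗ₜ[k]
        ofCoords q (expMat q (dualWord q m w)) := by
  rw [coevMetric, map_sum]
  refine Finset.sum_congr rfl fun w _ => ?_
  rw [map_sum, ← proj_metric q hq',
    pi_eq_sum_univ' (fun v : Fin m → Idx => ∏ i, metric q (w i) (v i.rev)), map_sum,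
    TensorProduct.tmul_sum]
  refine Finset.sum_congr rfl fun v _ => ?_
  rw [map_smul, map_smul, TensorProduct.map_tmul, TensorProduct.tmul_smul]
  rfl

theorem expMat_supported (q : kˣ) (m : ℕ) (b : Model k) (hb : ∀ K, m ≠ monDeg K → b K = 0)
    (K : Fin 16) (hK : m ≠ monDeg K) : expMat q b K = 0 := by
  simp [Fin.forall_fin_succ, monDeg] at hb
  rw [expMat_apply]
  fin_cases K <;> simp [monDeg] at hK ⊢ <;> (try simp_all)

theorem ofCoords_mem_extDeg (q : kˣ) (m : ℕ) (b : Model k) (hb : ∀ K, m ≠ monDeg K → b K = 0) :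
    ofCoords q b ∈ extDeg q m := by
  rw [ofCoords_apply]
  refine Submodule.sum_mem _ fun K _ => ?_
  by_cases hK : m = monDeg K
  · rw [hK]
    exact Submodule.smul_mem _ _ (mon_mem_extDeg q K)
  · rw [hb K hK, zero_smul]
    exact Submodule.zero_mem _

/-- If $f_K$ lifts the $K$-th monomial, then $[m,-\Psi]!f_K$ has coefficient `dualWord q m w K` at
the word `w`. Summing over $K$ first reassembles `expMat q (dualWord q m w)`, which is the second
factor of the coevaluation at `w`. -/
theorem isExpDeg_expPart (q : kˣ) (hq' : (q : k) ^ 2 ≠ -1) (m : ℕ) :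
    IsExpDeg q m (expPart q m) := by
  -- The conditional form, with the lift $0$ for monomials of other degrees, lets `choose` give
  -- functions on all of `Fin 16`.
  have hf : ∀ K, ∃ f : Tens k m, monDeg K = m → proj q m f = mon q K := fun K => by
    by_cases hK : monDeg K = m
    · subst hK
      obtain ⟨f, hf⟩ := mon_mem_extDeg q K
      exact ⟨f, fun _ => hf⟩
    · exact ⟨0, fun h => absurd h hK⟩
  have hg : ∀ K, ∃ g : Tens k m,
      monDeg K = m → proj q m g = ofCoords q (expMat q (Pi.single K 1)) := fun K => by
    by_cases hK : monDeg K = m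
    · obtain ⟨g, hg⟩ := ofCoords_mem_extDeg q m (expMat q (Pi.single K 1))
        (expMat_supported q m _ fun L hL => Pi.single_eq_of_ne (by rintro rfl; exact hL hK.symm) 1)
      exact ⟨g, fun _ => hg⟩
    · exact ⟨0, fun h => absurd h hK⟩
  choose f hf using hf
  choose g hg using hg
  refine ⟨∑ K with monDeg K = m, f K ⊗ₜ[k] g K, ?_, ?_⟩
  · have hfact : ∀ K, monDeg K = m → braidedFact (-braiding q) m (f K) =
        ∑ w, dualWord q m w K • (Pi.single w 1 : Tens k m) := by
      intro K hK
      rw [← pi_eq_sum_univ' (fun w => dualWord q m w K)]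
      funext w
      rw [braidedFact_eq_sum, ← coords_proj, hf K hK, coords_mon]
      simp [Pi.single_apply]
    have hword : ∀ w, ofCoords q (expMat q (dualWord q m w)) =
        ∑ K with monDeg K = m, dualWord q m w K • ofCoords q (expMat q (Pi.single K 1)) := by
      intro w
      conv_lhs => rw [pi_eq_sum_univ' (dualWord q m w)]
      rw [map_sum, map_sum, Finset.sum_filter]
      refine Finset.sum_congr rfl fun K _ => ?_
      split_ifs with hK
      · rw [map_smul, map_smul]
      · rw [dualWord_supported q m w K (Ne.symm hK), zero_smul, map_zero, map_zero]
    rw [map_proj_coevMetric q hq', map_sum]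
    simp only [hword, TensorProduct.tmul_sum]
    rw [Finset.sum_comm]
    refine Finset.sum_congr rfl fun K hK => ?_
    have hK : monDeg K = m := (Finset.mem_filter.1 hK).2
    rw [TensorProduct.map_tmul, hfact K hK, hg K hK, TensorProduct.sum_tmul]
    refine Finset.sum_congr rfl fun w _ => ?_
    rw [TensorProduct.tmul_smul, TensorProduct.smul_tmul']
  · rw [map_sum, expPart]
    refine Finset.sum_congr rfl fun K hK => ?_
    have hK : monDeg K = m := (Finset.mem_filter.1 hK).2
    rw [TensorProduct.map_tmul, hf K hK, hg K hK]

theorem existsUnique_isExpDeg (q : kˣ) (hq' : (q : k) ^ 2 ≠ -1) (m : ℕ) :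
    ∃! E : ExtAlg q ⊗[k] ExtAlg q, IsExpDeg q m E :=
  ⟨expPart q m, isExpDeg_expPart q hq' m, fun _ hE => hE.unique q (isExpDeg_expPart q hq' m)⟩

theorem expDeg_eq (q : kˣ) (hq' : (q : k) ^ 2 ≠ -1) (m : ℕ) : expDeg q m = expPart q m :=
  IsExpDeg.unique q (Classical.epsilon_spec (existsUnique_isExpDeg q hq' m).exists)
    (isExpDeg_expPart q hq' m)

theorem exp_eq (q : kˣ) (hq' : (q : k) ^ 2 ≠ -1) :
    exp q = ∑ K, mon q K ⊗ₜ[k] ofCoords q (expMat q (Pi.single K 1)) := by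
  simp only [exp, expDeg_eq q hq', expPart]
  refine Finset.sum_fiberwise_of_maps_to (fun K _ => ?_) _
  revert K
  decide

/-! ### The Hodge star -/

/-- The integral reads off the top coordinate, so the coefficient of the $K$-th second factor of
$\exp$ is the top coordinate of $\omega$ times the $K$-th monomial. -/
theorem sharp_eq (q : kˣ) (hq' : (q : k) ^ 2 ≠ -1) (ω : ExtAlg q) :
    sharp q ω = ofCoords q (expMat q fun K => extRep q ω (Pi.single K 1) 15) := by
  have h : sharp q ω = TensorProduct.lid k (ExtAlg q)
    (TensorProduct.map (integral q ∘ₗ LinearMap.mulLeft k ω) LinearMap.id (exp q)) := rfl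
  rw [h, exp_eq q hq', map_sum, map_sum,
    pi_eq_sum_univ' (fun K => extRep q ω (Pi.single K 1) 15), map_sum, map_sum]
  refine Finset.sum_congr rfl fun K _ => ?_
  rw [TensorProduct.map_tmul, TensorProduct.lid_tmul, map_smul, map_smul, integral_eq,
    LinearMap.comp_apply, LinearMap.comp_apply, LinearMap.mulLeft_apply, coords_mul, coords_mon]
  rfl

theorem coords_sharp_mon (q : kˣ) (hq' : (q : k) ^ 2 ≠ -1) (L : Fin 16) :
    coords q (sharp q (mon q L)) = hodge q (Pi.single L 1) := by
  have h0 : (q : k) ≠ 0 := q.ne_zero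
  rw [sharp_eq q hq', coords_ofCoords, expMat_apply, hodge_apply]
  fin_cases L <;>
    simp [mon, ea, eb, ec, ed, extRep_e, leftMul_a, leftMul_b, leftMul_c, leftMul_d] <;>
    (try repeat' apply And.intro) <;> (try field_simp) <;> (try ring)

theorem coords_sharp (q : kˣ) (hq' : (q : k) ^ 2 ≠ -1) (ω : ExtAlg q) :
    coords q (sharp q ω) = hodge q (coords q ω) := by
  have h : coords q ∘ₗ sharp q ∘ₗ ofCoords q = hodge q :=
    (Pi.basisFun k (Fin 16)).ext fun L => by
      rw [Pi.basisFun_apply, LinearMap.comp_apply, LinearMap.comp_apply, ofCoords_single,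
        coords_sharp_mon q hq']
  rw [← h, LinearMap.comp_apply, LinearMap.comp_apply, ofCoords_coords]

theorem mu_eq (q : kˣ) (hq' : (q : k) ^ 2 ≠ -1) : mu q = (q : k) ^ 6 := by
  rw [mu, exp_eq q hq', map_sum, map_sum, integral_eq, Finset.sum_eq_single 15]
  · rw [TensorProduct.map_tmul, TensorProduct.lid_tmul, LinearMap.comp_apply, LinearMap.comp_apply,
      coords_mon, coords_ofCoords, expMat_apply]
    simp
  · intro K _ hK
    rw [TensorProduct.map_tmul, TensorProduct.lid_tmul, LinearMap.comp_apply, coords_mon,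
      LinearMap.proj_apply, Pi.single_eq_of_ne (Ne.symm hK), zero_smul]
  · simp

theorem sharp_sharp (q : kˣ) (hq' : (q : k) ^ 2 ≠ -1) {m : ℕ} (hm : m ≠ 2) {ω : ExtAlg q}
    (hω : ω ∈ extDeg q m) : sharp q (sharp q ω) = (q : k) ^ 6 • ω :=
  coords_injective q <| by
    rw [coords_sharp q hq', coords_sharp q hq', map_smul,
      hodge_hodge q m hm _ (coords_supported q hω)]

theorem sharp_sharp_two (q : kˣ) (hq' : (q : k) ^ 2 ≠ -1) {ω : ExtAlg q} (hω : ω ∈ extDeg q 2) :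
    sharp q (sharp q ω) = (q : k) ^ 6 • ω + ((q : k) ^ 4 - (q : k) ^ 2) • sharp q ω :=
  coords_injective q <| by
    rw [coords_sharp q hq', coords_sharp q hq', map_add, map_smul, map_smul, coords_sharp q hq',
      hodge_hecke q _ (coords_supported q hω)]

theorem sharp_mon (q : kˣ) (hq' : (q : k) ^ 2 ≠ -1) (L : Fin 16) :
    sharp q (mon q L) = ∑ K, hodge q (Pi.single L 1) K • mon q K := by
  rw [← ofCoords_coords q (sharp q (mon q L)), coords_sharp_mon q hq', ofCoords_apply]

/-- With `T` a polynomial in $\sharp$, this carries each relation from $\Lambda^m$ to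
$A\otimes\Lambda^m$. -/
theorem lTensor_eq_zero_of_mem_omegaDeg (q : kˣ) {m : ℕ} (T : ExtAlg q →ₗ[k] ExtAlg q)
    (hT : ∀ ω ∈ extDeg q m, T ω = 0) {ω : QSL2 q ⊗[k] ExtAlg q} (hω : ω ∈ omegaDeg q m) :
    T.lTensor (QSL2 q) ω = 0 := by
  obtain ⟨x, rfl⟩ := hω
  have h : T ∘ₗ (extDeg q m).subtype = 0 := LinearMap.ext fun η => hT η η.2
  rw [← LinearMap.comp_apply, ← LinearMap.lTensor_comp, h, LinearMap.lTensor_zero,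
    LinearMap.zero_apply]

theorem sharpOmega_sharpOmega (q : kˣ) (hq' : (q : k) ^ 2 ≠ -1) {m : ℕ} (hm : m ≠ 2)
    {ω : QSL2 q ⊗[k] ExtAlg q} (hω : ω ∈ omegaDeg q m) :
    sharpOmega q (sharpOmega q ω) = (q : k) ^ 6 • ω := by
  have h := lTensor_eq_zero_of_mem_omegaDeg q (sharp q ∘ₗ sharp q - (q : k) ^ 6 • LinearMap.id)
    (fun η hη => by simp [sharp_sharp q hq' hm hη]) hω
  rw [LinearMap.lTensor_sub, LinearMap.lTensor_comp, LinearMap.lTensor_smul, LinearMap.lTensor_id,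
    LinearMap.sub_apply, sub_eq_zero] at h
  exact h

theorem sharpOmega_sharpOmega_two (q : kˣ) (hq' : (q : k) ^ 2 ≠ -1)
    {ω : QSL2 q ⊗[k] ExtAlg q} (hω : ω ∈ omegaDeg q 2) :
    sharpOmega q (sharpOmega q ω) =
      (q : k) ^ 6 • ω + ((q : k) ^ 4 - (q : k) ^ 2) • sharpOmega q ω := by
  have h := lTensor_eq_zero_of_mem_omegaDeg q (sharp q ∘ₗ sharp q -
    ((q : k) ^ 6 • LinearMap.id + ((q : k) ^ 4 - (q : k) ^ 2) • sharp q))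
    (fun η hη => by simp [sharp_sharp_two q hq' hη]) hω
  rw [LinearMap.lTensor_sub, LinearMap.lTensor_comp, LinearMap.lTensor_add, LinearMap.lTensor_smul,
    LinearMap.lTensor_smul, LinearMap.lTensor_id, LinearMap.sub_apply, sub_eq_zero] at h
  exact h

/-! ### Factored and normalised relations for an arbitrary operator, shared by $\Lambda$ and
$\Omega$. -/

section Relations

variable {M : Type*} [AddCommGroup M] [Module k M] (T : M →ₗ[k] M) (q : kˣ) {ω : M}

theorem hecke_factor
    (h : T (T ω) = (q : k) ^ 6 • ω + ((q : k) ^ 4 - (q : k) ^ 2) • T ω) :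
    (T - (q : k) ^ 4 • (LinearMap.id : M →ₗ[k] M))
      ((T + (q : k) ^ 2 • (LinearMap.id : M →ₗ[k] M)) ω) = 0 := by
  simp only [LinearMap.sub_apply, LinearMap.add_apply, LinearMap.smul_apply, LinearMap.id_apply,
    map_add, map_smul, h]
  module

theorem normalised_involution (h : T (T ω) = (q : k) ^ 6 • ω) :
    (((q : k) ^ 3)⁻¹ • T) ((((q : k) ^ 3)⁻¹ • T) ω) = ω := by
  have h0 : (q : k) ≠ 0 := q.ne_zero
  simp only [LinearMap.smul_apply, map_smul, h, smul_smul]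
  rw [show ((q : k) ^ 3)⁻¹ * (((q : k) ^ 3)⁻¹ * (q : k) ^ 6) = 1 by field_simp, one_smul]

theorem normalised_hecke
    (h : T (T ω) = (q : k) ^ 6 • ω + ((q : k) ^ 4 - (q : k) ^ 2) • T ω) :
    (((q : k) ^ 3)⁻¹ • T) ((((q : k) ^ 3)⁻¹ • T) ω) =
      ω + ((q : k) - (q : k)⁻¹) • (((q : k) ^ 3)⁻¹ • T) ω := by
  have h0 : (q : k) ≠ 0 := q.ne_zero
  simp only [LinearMap.smul_apply, map_smul, h]
  match_scalars <;> field_simp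

end Relations

end

end QHodge

open QHodge
theorem mainTheorem3 {k : Type*} [Field k] (q : kˣ)
    (hq : (q : k) ^ 2 ≠ 1) (hq' : (q : k) ^ 2 ≠ -1) :
    -- the Hodge star is well defined: dimensions of `Λ`, the integral, the element `exp`
    (∀ m : ℕ, Module.finrank k (extDeg q m) = Nat.choose 4 m) ∧
    (∃! I : ExtAlg q →ₗ[k] k, IsExtIntegral q I) ∧
    (∀ m : ℕ, ∃! E : ExtAlg q ⊗[k] ExtAlg q, IsExpDeg q m E) ∧
    -- the constant `μ` and the table of values of `♯`
    mu q = (q : k) ^ 6 ∧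
    sharp q 1 = (q : k) ^ 6 • vol q ∧
    sharp q (ea q) = -((q : k) ^ 4 • (ea q * eb q * ec q)) ∧
    sharp q (eb q) = -((q : k) ^ 4 • (ea q * eb q * ed q)) ∧
    sharp q (ec q) = (q : k) ^ 6 • (ea q * ec q * ed q) ∧
    sharp q (ed q) =
      (q : k) ^ 4 • (eb q * ec q * ed q) + (lam q * (q : k) ^ 4) • (ea q * eb q * ec q) ∧
    sharp q (ea q * eb q) = -((q : k) ^ 2 • (ea q * eb q)) ∧
    sharp q (ea q * ec q) = (q : k) ^ 4 • (ea q * ec q) ∧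
    sharp q (ea q * ed q) = (q : k) ^ 2 • (eb q * ec q) + (lam q * (q : k) ^ 4) • (ea q * ed q) ∧
    sharp q (eb q * ec q) = (q : k) ^ 4 • (ea q * ed q) ∧
    sharp q (eb q * ed q) = (q : k) ^ 4 • (eb q * ed q) + (1 - (q : k) ^ 4) • (ea q * eb q) ∧
    sharp q (ec q * ed q) = -((q : k) ^ 2 • (ec q * ed q)) ∧
    sharp q (ea q * eb q * ec q) = -((q : k) ^ 2 • ea q) ∧
    sharp q (ea q * eb q * ed q) = -((q : k) ^ 2 • eb q) ∧
    sharp q (ea q * ec q * ed q) = ec q ∧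
    sharp q (eb q * ec q * ed q) = (q : k) ^ 2 • ed q + (lam q * (q : k) ^ 2) • ea q ∧
    sharp q (vol q) = 1 ∧
    -- the relations on the invariant forms `Λ^m`
    (∀ m : ℕ, m ≠ 2 → ∀ ω ∈ extDeg q m, sharp q (sharp q ω) = (q : k) ^ 6 • ω) ∧
    (∀ ω ∈ extDeg q 2,
      (sharp q - (q : k) ^ 4 • (LinearMap.id : ExtAlg q →ₗ[k] ExtAlg q))
        ((sharp q + (q : k) ^ 2 • (LinearMap.id : ExtAlg q →ₗ[k] ExtAlg q)) ω) = 0) ∧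
    -- the relations on all forms `Ω^m = A ⊗ Λ^m`
    (∀ m : ℕ, m ≠ 2 → ∀ ω ∈ omegaDeg q m, sharpOmega q (sharpOmega q ω) = (q : k) ^ 6 • ω) ∧
    (∀ ω ∈ omegaDeg q 2,
      (sharpOmega q - (q : k) ^ 4 • (LinearMap.id : QSL2 q ⊗[k] ExtAlg q →ₗ[k] QSL2 q ⊗[k] ExtAlg q))
        ((sharpOmega q +
          (q : k) ^ 2 • (LinearMap.id : QSL2 q ⊗[k] ExtAlg q →ₗ[k] QSL2 q ⊗[k] ExtAlg q)) ω) = 0) ∧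
    -- the normalised Hodge star `♯' = q⁻³ ♯`
    (∀ m : ℕ, m ≠ 2 → ∀ ω ∈ extDeg q m, sharpNorm q (sharpNorm q ω) = ω) ∧
    (∀ ω ∈ extDeg q 2,
      sharpNorm q (sharpNorm q ω) = ω + ((q : k) - (q : k)⁻¹) • sharpNorm q ω) ∧
    (∀ m : ℕ, m ≠ 2 → ∀ ω ∈ omegaDeg q m, sharpOmegaNorm q (sharpOmegaNorm q ω) = ω) ∧
    (∀ ω ∈ omegaDeg q 2,
      sharpOmegaNorm q (sharpOmegaNorm q ω) =
        ω + ((q : k) - (q : k)⁻¹) • sharpOmegaNorm q ω) := by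
  have h0 : (q : k) ≠ 0 := q.ne_zero
  -- The sixteen rows of the table are the columns of `hodge`, since each argument of $\sharp$ is
  -- definitionally `mon q L`.
  refine ⟨finrank_extDeg q, existsUnique_isExtIntegral q, existsUnique_isExpDeg q hq', mu_eq q hq',
    (sharp_mon q hq' 0).trans ?_, (sharp_mon q hq' 1).trans ?_, (sharp_mon q hq' 2).trans ?_,
    (sharp_mon q hq' 3).trans ?_, (sharp_mon q hq' 4).trans ?_, (sharp_mon q hq' 5).trans ?_,
    (sharp_mon q hq' 6).trans ?_, (sharp_mon q hq' 7).trans ?_, (sharp_mon q hq' 8).trans ?_,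
    (sharp_mon q hq' 9).trans ?_, (sharp_mon q hq' 10).trans ?_, (sharp_mon q hq' 11).trans ?_,
    (sharp_mon q hq' 12).trans ?_, (sharp_mon q hq' 13).trans ?_, (sharp_mon q hq' 14).trans ?_,
    (sharp_mon q hq' 15).trans ?_, fun m hm ω hω => sharp_sharp q hq' hm hω,
    fun ω hω => hecke_factor _ q (sharp_sharp_two q hq' hω),
    fun m hm ω hω => sharpOmega_sharpOmega q hq' hm hω,
    fun ω hω => hecke_factor _ q (sharpOmega_sharpOmega_two q hq' hω),
    fun m hm ω hω => normalised_involution _ q (sharp_sharp q hq' hm hω),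
    fun ω hω => normalised_hecke _ q (sharp_sharp_two q hq' hω),
    fun m hm ω hω => normalised_involution _ q (sharpOmega_sharpOmega q hq' hm hω),
    fun ω hω => normalised_hecke _ q (sharpOmega_sharpOmega_two q hq' hω)⟩
  all_goals
    simp [hodge_apply, Fin.sum_univ_succ, mon, vol, lam]
  all_goals
    match_scalars <;> field_simp
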